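/- Let $\Bbbk$ be a field and let $C$ be a finite-dimensional (coassociative, counital) $\Bbbk$-coalgebra. The free Hopf algebra on $C$ is the Hopf $\Bbbk$-algebra $H_f(C)$ equipped with a coalgebra morphism $\iota\colon C\to H_f(C)$ such that every coalgebra morphism from $C$ to a Hopf $\Bbbk$-algebra $K$ factors uniquely as $\varphi\circ\iota$ for a Hopf algebra morphism $\varphi\colon H_f(C)\to K$. Let $\overline{\Bbbk}$ be an algebraic closure of $\Bbbk$ and $C_{\overline{\Bbbk}}:=\overline{\Bbbk}\otimes_{\Bbbk}C$ the coalgebra over $\overline{\Bbbk}$ obtained by extension of scalars. Then $H_f(C)$ is affine over $\Bbbk$ (i.e. finitely generated as a $\Bbbk$-algebra) if and only if $C_{\overline{\Bbbk}}$ is pointed (i.e. every simple subcoalgebra of $C_{\overline{\Bbbk}}$ is one-dimensional over $\overline{\Bbbk}$). -/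

import Mathlib

open scoped TensorProduct

universe u v w

section Twist

variable (k : Type u) (C : Type v) [Field k] [AddCommGroup C] [Module k C] [Coalgebra k C]

/-- The comultiplication of the `n`-fold co-opposite of `C`: it is `Δ` for even `n` and `Δ`
followed by the flip for odd `n`. -/
noncomputable def twistedComul (n : ℕ) : C →ₗ[k] C ⊗[k] C :=
  if Even n then Coalgebra.comul
  else (TensorProduct.comm k C C).toLinearMap ∘ₗ Coalgebra.comul

/-- The degree `n` inclusion of `C` into the tensor algebra of `C ⊕ C ⊕ C ⊕ ⋯`. -/
noncomputable def preGen (n : ℕ) : C →ₗ[k] TensorAlgebra k (ℕ →₀ C) :=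
  TensorAlgebra.ι k ∘ₗ Finsupp.lsingle n

/-- The relations `∑ x₁ S(x₂) = ε(x) = ∑ S(x₁) x₂`, where `x` runs over the `n`-th copy of `C`
(with comultiplication `twistedComul k C n`) and `S` moves the `n`-th copy of `C`
identically onto the `(n+1)`-st. -/
inductive FreeHopfRel : TensorAlgebra k (ℕ →₀ C) → TensorAlgebra k (ℕ →₀ C) → Prop
  | right (n : ℕ) (c : C) : FreeHopfRel
      (LinearMap.mul' k _
        (TensorProduct.map (preGen k C n) (preGen k C (n + 1)) (twistedComul k C n c)))
      (algebraMap k _ (Coalgebra.counit (R := k) c))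
  | left (n : ℕ) (c : C) : FreeHopfRel
      (LinearMap.mul' k _
        (TensorProduct.map (preGen k C (n + 1)) (preGen k C n) (twistedComul k C n c)))
      (algebraMap k _ (Coalgebra.counit (R := k) c))

/-- The (underlying algebra of the) free Hopf algebra on the coalgebra `C`. -/
def FreeHopfAlgebra : Type (max u v) := RingQuot (FreeHopfRel k C)

namespace FreeHopfAlgebra

noncomputable instance : Ring (FreeHopfAlgebra k C) :=
  inferInstanceAs (Ring (RingQuot (FreeHopfRel k C)))

noncomputable instance instAlg : Algebra k (FreeHopfAlgebra k C) :=
  inferInstanceAs (Algebra k (RingQuot (FreeHopfRel k C)))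

/-- The quotient map from the tensor algebra. -/
noncomputable def mk : TensorAlgebra k (ℕ →₀ C) →ₐ[k] FreeHopfAlgebra k C :=
  RingQuot.mkAlgHom k (FreeHopfRel k C)

/-- The `n`-th copy of `C` in the free Hopf algebra, `c ↦ Sⁿ(c)`. -/
noncomputable def gen (n : ℕ) : C →ₗ[k] FreeHopfAlgebra k C :=
  (mk k C).toLinearMap ∘ₗ preGen k C n

/-- The `n`-fold co-opposite coalgebra of `C`. -/
def IterCop (_n : ℕ) : Type v := C

instance (n : ℕ) : AddCommGroup (IterCop C n) := inferInstanceAs (AddCommGroup C)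
instance (n : ℕ) : Module k (IterCop C n) := inferInstanceAs (Module k C)

theorem cop_coassoc :
    TensorProduct.assoc k C C C ∘ₗ
      ((TensorProduct.comm k C C).toLinearMap ∘ₗ Coalgebra.comul).rTensor C ∘ₗ
        ((TensorProduct.comm k C C).toLinearMap ∘ₗ Coalgebra.comul) =
    ((TensorProduct.comm k C C).toLinearMap ∘ₗ Coalgebra.comul).lTensor C ∘ₗ
        ((TensorProduct.comm k C C).toLinearMap ∘ₗ Coalgebra.comul) := by
  ext c
  have h := Coalgebra.coassoc_symm_apply (R := k) c
  let F : (C ⊗[k] C) ⊗[k] C →ₗ[k] C ⊗[k] (C ⊗[k] C) :=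
    (TensorProduct.comm k (C ⊗[k] C) C).toLinearMap ∘ₗ
      (TensorProduct.comm k C C).toLinearMap.rTensor C
  have h2 := congrArg F h
  have e1 : ∀ z : C ⊗[k] C,
      F ((TensorProduct.assoc k C C C).symm ((Coalgebra.comul (R := k)).lTensor C z)) =
      TensorProduct.assoc k C C C
        (((TensorProduct.comm k C C).toLinearMap ∘ₗ Coalgebra.comul).rTensor C
          (TensorProduct.comm k C C z)) := by
    intro z
    induction z with
    | zero => simp
    | add x y hx hy => simp only [map_add, hx, hy]
    | tmul x y =>
      simp only [LinearMap.lTensor_tmul, TensorProduct.comm_tmul, LinearMap.rTensor_tmul,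
        LinearMap.comp_apply, LinearEquiv.coe_coe]
      generalize Coalgebra.comul (R := k) y = w
      induction w with
      | zero => simp
      | add x y hx hy => simp only [TensorProduct.tmul_add, TensorProduct.add_tmul, map_add, hx, hy]
      | tmul a b => simp [F]
  have e2 : ∀ z : C ⊗[k] C,
      F ((Coalgebra.comul (R := k)).rTensor C z) =
        ((TensorProduct.comm k C C).toLinearMap ∘ₗ Coalgebra.comul).lTensor C
          (TensorProduct.comm k C C z) := by
    intro z
    induction z with
    | zero => simp
    | add x y hx hy => simp only [map_add, hx, hy]
    | tmul x y => simp [F]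
  rw [e1, e2] at h2
  simpa using h2

theorem cop_rTensor :
    (Coalgebra.counit (R := k)).rTensor C ∘ₗ
      ((TensorProduct.comm k C C).toLinearMap ∘ₗ Coalgebra.comul) = TensorProduct.mk k k C 1 := by
  ext c
  have h := congrArg (TensorProduct.comm k C k) (Coalgebra.lTensor_counit_comul (R := k) c)
  rw [TensorProduct.comm_tmul, ← LinearMap.rTensor_comm] at h
  exact h

theorem cop_lTensor :
    (Coalgebra.counit (R := k)).lTensor C ∘ₗ
      ((TensorProduct.comm k C C).toLinearMap ∘ₗ Coalgebra.comul) =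
        (TensorProduct.mk k C k).flip 1 := by
  ext c
  have h := congrArg (TensorProduct.comm k k C) (Coalgebra.rTensor_counit_comul (R := k) c)
  rw [TensorProduct.comm_tmul, ← LinearMap.lTensor_comm] at h
  exact h

noncomputable instance instCoalgebraIterCop (n : ℕ) : Coalgebra k (IterCop C n) where
  comul := twistedComul k C n
  counit := Coalgebra.counit (R := k) (A := C)
  coassoc := by
    unfold twistedComul
    split_ifs
    · exact Coalgebra.coassoc (R := k) (A := C)
    · exact cop_coassoc k C
  rTensor_counit_comp_comul := by
    unfold twistedComul
    split_ifs
    · exact Coalgebra.rTensor_counit_comp_comul (R := k) (A := C)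
    · exact cop_rTensor k C
  lTensor_counit_comp_comul := by
    unfold twistedComul
    split_ifs
    · exact Coalgebra.lTensor_counit_comp_comul (R := k) (A := C)
    · exact cop_lTensor k C

theorem twistedComul_succ (n : ℕ) (c : C) :
    twistedComul k C (n + 1) c = TensorProduct.comm k C C (twistedComul k C n c) := by
  unfold twistedComul
  by_cases h : Even n <;> simp [h, Nat.even_add_one]

variable {k C}

section Lift

variable {A : Type w} [Ring A] [Algebra k A]

open WithConv

/-- A linear map out of `C`, as an element of the convolution algebra of the `n`-fold
co-opposite of `C`. -/
def conv (n : ℕ) (f : C →ₗ[k] A) : WithConv (IterCop C n →ₗ[k] A) := toConv f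

theorem conv_mul_apply (n : ℕ) (f g : C →ₗ[k] A) (c : C) :
    (conv n f * conv n g).ofConv c =
      LinearMap.mul' k A (TensorProduct.map f g (twistedComul k C n c)) := rfl

theorem conv_mul_eq_one_iff (n : ℕ) (f g : C →ₗ[k] A) :
    conv n f * conv n g = 1 ↔ ∀ c : C,
      LinearMap.mul' k A (TensorProduct.map f g (twistedComul k C n c)) =
        algebraMap k A (Coalgebra.counit (R := k) c) := by
  constructor
  · intro h c
    exact congrArg (fun z => z.ofConv c) h
  · intro h
    apply WithConv.ext
    exact LinearMap.ext h

/-- The algebra map out of the free Hopf algebra determined by a compatible sequence of linear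
maps out of `C`. -/
noncomputable def lift (f : ℕ → C →ₗ[k] A)
    (hr : ∀ n, conv n (f n) * conv n (f (n + 1)) = 1)
    (hl : ∀ n, conv n (f (n + 1)) * conv n (f n) = 1) : FreeHopfAlgebra k C →ₐ[k] A :=
  RingQuot.liftAlgHom k ⟨TensorAlgebra.lift k (Finsupp.lsum k f), by
    have key : ∀ (n m l : ℕ) (c : C),
        TensorAlgebra.lift k (Finsupp.lsum k f)
          (LinearMap.mul' k _
            (TensorProduct.map (preGen k C n) (preGen k C m) (twistedComul k C l c))) =
        LinearMap.mul' k A (TensorProduct.map (f n) (f m) (twistedComul k C l c)) := by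
      intro n m l c
      generalize twistedComul k C l c = z
      induction z with
      | zero => simp
      | add x y hx hy => simp only [map_add, hx, hy]
      | tmul x y => simp [preGen]
    rintro _ _ (⟨n, c⟩ | ⟨n, c⟩)
    · rw [key, AlgHom.commutes]; exact (conv_mul_eq_one_iff n _ _).1 (hr n) c
    · rw [key, AlgHom.commutes]; exact (conv_mul_eq_one_iff n _ _).1 (hl n) c⟩

@[simp] theorem lift_gen (f : ℕ → C →ₗ[k] A) (hr hl) (n : ℕ) (c : C) :
    lift f hr hl (gen k C n c) = f n c := by
  refine (RingQuot.liftAlgHom_mkAlgHom_apply _ _ _ _).trans ?_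
  simp [preGen]

theorem algHom_ext {f g : FreeHopfAlgebra k C →ₐ[k] A}
    (h : ∀ n c, f (gen k C n c) = g (gen k C n c)) : f = g := by
  apply RingQuot.ringQuot_ext'
  ext n c
  exact h n c

theorem induction_on {p : FreeHopfAlgebra k C → Prop} (x : FreeHopfAlgebra k C)
    (halg : ∀ r : k, p (algebraMap k _ r)) (hgen : ∀ n c, p (gen k C n c))
    (hadd : ∀ x y, p x → p y → p (x + y)) (hmul : ∀ x y, p x → p y → p (x * y)) : p x := by
  let S : Subalgebra k (FreeHopfAlgebra k C) :=
    { carrier := {x | p x}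
      mul_mem' := fun {a b} ha hb => hmul a b ha hb
      add_mem' := fun {a b} ha hb => hadd a b ha hb
      algebraMap_mem' := halg }
  obtain ⟨y, rfl⟩ := RingQuot.mkAlgHom_surjective k (FreeHopfRel k C) x
  change mk k C y ∈ S
  induction y using TensorAlgebra.induction with
  | algebraMap r => rw [AlgHom.commutes]; exact S.algebraMap_mem r
  | ι x =>
    induction x using Finsupp.induction_linear with
    | zero => rw [map_zero, map_zero]; exact S.zero_mem
    | add a b ha hb => rw [map_add, map_add]; exact S.add_mem ha hb
    | single n c => exact hgen n c
  | mul a b ha hb => rw [map_mul]; exact S.mul_mem ha hb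
  | add a b ha hb => rw [map_add]; exact S.add_mem ha hb

variable (k C) in
theorem gen_right (n : ℕ) : conv n (gen k C n) * conv n (gen k C (n + 1)) = 1 := by
  rw [conv_mul_eq_one_iff]
  intro c
  have h : mk k C _ = mk k C _ := RingQuot.mkAlgHom_rel k (FreeHopfRel.right (k := k) n c)
  rw [AlgHom.commutes] at h
  refine Eq.trans ?_ h
  generalize twistedComul k C n c = z
  induction z with
  | zero => simp
  | add x y hx hy => simp only [map_add, hx, hy]
  | tmul x y => simp only [TensorProduct.map_tmul, LinearMap.mul'_apply, map_mul]; rfl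

variable (k C) in
theorem gen_left (n : ℕ) : conv n (gen k C (n + 1)) * conv n (gen k C n) = 1 := by
  rw [conv_mul_eq_one_iff]
  intro c
  have h : mk k C _ = mk k C _ := RingQuot.mkAlgHom_rel k (FreeHopfRel.left (k := k) n c)
  rw [AlgHom.commutes] at h
  refine Eq.trans ?_ h
  generalize twistedComul k C n c = z
  induction z with
  | zero => simp
  | add x y hx hy => simp only [map_add, hx, hy]
  | tmul x y => simp only [TensorProduct.map_tmul, LinearMap.mul'_apply, map_mul]; rfl

theorem conv_comp_mul {B : Type*} [Ring B] [Algebra k B] (n : ℕ) (φ : A →ₐ[k] B)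
    {f g : C →ₗ[k] A} (h : conv n f * conv n g = 1) :
    conv n (φ.toLinearMap ∘ₗ f) * conv n (φ.toLinearMap ∘ₗ g) = 1 := by
  rw [conv_mul_eq_one_iff] at h ⊢
  intro c
  rw [← AlgHom.commutes φ, ← h]
  generalize twistedComul k C n c = z
  induction z with
  | zero => simp
  | add x y hx hy => simp only [map_add, hx, hy]
  | tmul x y => simp

/-- `Δ` on the `n`-th copy of `C`. -/
noncomputable def comulGen (n : ℕ) : C →ₗ[k] FreeHopfAlgebra k C ⊗[k] FreeHopfAlgebra k C :=
  TensorProduct.map (gen k C n) (gen k C n) ∘ₗ twistedComul k C n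

/-- `h ↦ h ⊗ 1`. -/
noncomputable abbrev iL : FreeHopfAlgebra k C →ₐ[k] FreeHopfAlgebra k C ⊗[k] FreeHopfAlgebra k C :=
  Algebra.TensorProduct.includeLeft

/-- `h ↦ 1 ⊗ h`. -/
noncomputable abbrev iR : FreeHopfAlgebra k C →ₐ[k] FreeHopfAlgebra k C ⊗[k] FreeHopfAlgebra k C :=
  Algebra.TensorProduct.includeRight

theorem conv_comulGen (n : ℕ) : conv n (comulGen (k := k) (C := C) n) =
    conv n (iL.toLinearMap ∘ₗ gen k C n) * conv n (iR.toLinearMap ∘ₗ gen k C n) := by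
  apply WithConv.ext
  apply LinearMap.ext
  intro (c : C)
  rw [conv_mul_apply]
  change TensorProduct.map (gen k C n) (gen k C n) (twistedComul k C n c) = _
  generalize twistedComul k C n c = z
  induction z with
  | zero => simp
  | add x y hx hy => simp only [map_add, hx, hy]
  | tmul x y => simp

theorem conv_comulGen_succ (n : ℕ) : conv n (comulGen (k := k) (C := C) (n + 1)) =
    conv n (iR.toLinearMap ∘ₗ gen k C (n + 1)) * conv n (iL.toLinearMap ∘ₗ gen k C (n + 1)) := by
  apply WithConv.ext
  apply LinearMap.ext
  intro (c : C)
  rw [conv_mul_apply]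
  change TensorProduct.map (gen k C (n + 1)) (gen k C (n + 1)) (twistedComul k C (n + 1) c) = _
  rw [twistedComul_succ]
  generalize twistedComul k C n c = z
  induction z with
  | zero => simp
  | add x y hx hy => simp only [map_add, hx, hy]
  | tmul x y => simp

theorem comulGen_right (n : ℕ) :
    conv n (comulGen (k := k) (C := C) n) * conv n (comulGen (k := k) (C := C) (n + 1)) = 1 := by
  rw [conv_comulGen, conv_comulGen_succ, mul_assoc, ← mul_assoc (conv n (iR.toLinearMap ∘ₗ _)),
    conv_comp_mul n iR (gen_right k C n), one_mul, conv_comp_mul n iL (gen_right k C n)]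

theorem comulGen_left (n : ℕ) :
    conv n (comulGen (k := k) (C := C) (n + 1)) * conv n (comulGen (k := k) (C := C) n) = 1 := by
  rw [conv_comulGen, conv_comulGen_succ, mul_assoc, ← mul_assoc (conv n (iL.toLinearMap ∘ₗ _)),
    conv_comp_mul n iL (gen_left k C n), one_mul, conv_comp_mul n iR (gen_left k C n)]

theorem map_counit (f : C →ₗ[k] A) (n : ℕ) (c : C) :
    TensorProduct.map (Coalgebra.counit (R := k)) f (twistedComul k C n c) = 1 ⊗ₜ[k] f c := by
  have h := Coalgebra.rTensor_counit_comul (R := k) (A := IterCop C n) c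
  have h2 := congrArg (LinearMap.lTensor k (f : IterCop C n →ₗ[k] A)) h
  refine Eq.trans ?_ (h2.trans (LinearMap.lTensor_tmul k f 1 c))
  change _ = (LinearMap.lTensor k f) (LinearMap.rTensor C (Coalgebra.counit (R := k) (A := C))
    (twistedComul k C n c))
  generalize twistedComul k C n c = z
  induction z with
  | zero => simp
  | add x y hx hy => simp only [map_add, hx, hy]
  | tmul x y => simp

theorem map_counit' (f : C →ₗ[k] A) (n : ℕ) (c : C) :
    TensorProduct.map f (Coalgebra.counit (R := k)) (twistedComul k C n c) = f c ⊗ₜ[k] 1 := by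
  have h := Coalgebra.lTensor_counit_comul (R := k) (A := IterCop C n) c
  have h2 := congrArg (LinearMap.rTensor k (f : IterCop C n →ₗ[k] A)) h
  refine Eq.trans ?_ (h2.trans (LinearMap.rTensor_tmul k f 1 c))
  change _ = (LinearMap.rTensor k f) (LinearMap.lTensor C (Coalgebra.counit (R := k) (A := C))
    (twistedComul k C n c))
  generalize twistedComul k C n c = z
  induction z with
  | zero => simp
  | add x y hx hy => simp only [map_add, hx, hy]
  | tmul x y => simp

theorem counit_conv (n : ℕ) :
    conv n (Coalgebra.counit (R := k) (A := C)) * conv n (Coalgebra.counit (R := k)) = 1 := by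
  rw [conv_mul_eq_one_iff]
  intro c
  rw [map_counit]
  simp

end Lift

/-- The comultiplication: on the `n`-th copy of `C` it is the `n`-fold co-opposite of that
of `C`. -/
noncomputable def comulHom :
    FreeHopfAlgebra k C →ₐ[k] FreeHopfAlgebra k C ⊗[k] FreeHopfAlgebra k C :=
  lift comulGen comulGen_right comulGen_left

/-- The counit: on every copy of `C` it is the counit of `C`. -/
noncomputable def counitHom : FreeHopfAlgebra k C →ₐ[k] k :=
  lift (fun _ => Coalgebra.counit (R := k)) counit_conv counit_conv

theorem comulHom_gen (n : ℕ) (c : C) : comulHom (gen k C n c) =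
    TensorProduct.map (gen k C n) (gen k C n) (twistedComul k C n c) := by
  simp [comulHom, comulGen]

theorem counitHom_gen (n : ℕ) (c : C) :
    counitHom (gen k C n c) = Coalgebra.counit (R := k) c := by
  simp [counitHom]

noncomputable instance instBialgebra : Bialgebra k (FreeHopfAlgebra k C) :=
  Bialgebra.ofAlgHom comulHom counitHom
    (by
      apply algHom_ext
      intro n c
      have h := Coalgebra.coassoc_apply (R := k) (A := IterCop C n) c
      have h2 := congrArg (TensorProduct.map (gen k C n : IterCop C n →ₗ[k] _)
        (TensorProduct.map (gen k C n : IterCop C n →ₗ[k] _)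
          (gen k C n : IterCop C n →ₗ[k] _))) h
      change TensorProduct.map (gen k C n) (TensorProduct.map (gen k C n) (gen k C n))
          (TensorProduct.assoc k C C C
            ((twistedComul k C n).rTensor C (twistedComul k C n c))) =
        TensorProduct.map (gen k C n) (TensorProduct.map (gen k C n) (gen k C n))
            ((twistedComul k C n).lTensor C (twistedComul k C n c)) at h2
      have e1 : ∀ z : C ⊗[k] C, Algebra.TensorProduct.assoc k k k (FreeHopfAlgebra k C)
          (FreeHopfAlgebra k C) (FreeHopfAlgebra k C)
          (Algebra.TensorProduct.map comulHom (.id k (FreeHopfAlgebra k C))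
            (TensorProduct.map (gen k C n) (gen k C n) z)) =
          TensorProduct.map (gen k C n) (TensorProduct.map (gen k C n) (gen k C n))
            (TensorProduct.assoc k C C C ((twistedComul k C n).rTensor C z)) := by
        intro z
        induction z with
        | zero => simp
        | add x y hx hy => simp only [map_add, hx, hy]
        | tmul x y =>
          simp only [TensorProduct.map_tmul, Algebra.TensorProduct.map_tmul, comulHom_gen,
            LinearMap.rTensor_tmul]
          generalize twistedComul k C n x = w
          induction w with
          | zero => simp
          | add x y hx hy => simp only [map_add, TensorProduct.add_tmul, hx, hy]
          | tmul a b => simp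
      have e2 : ∀ z : C ⊗[k] C,
          Algebra.TensorProduct.map (.id k (FreeHopfAlgebra k C)) comulHom
            (TensorProduct.map (gen k C n) (gen k C n) z) =
          TensorProduct.map (gen k C n) (TensorProduct.map (gen k C n) (gen k C n))
            ((twistedComul k C n).lTensor C z) := by
        intro z
        induction z with
        | zero => simp
        | add x y hx hy => simp only [map_add, hx, hy]
        | tmul x y => simp [comulHom_gen]
      rw [← e1, ← e2, ← comulHom_gen] at h2
      exact h2)
    (by
      apply algHom_ext
      intro n c
      rw [AlgHom.comp_apply, comulHom_gen]
      have e : ∀ z : C ⊗[k] C,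
          Algebra.TensorProduct.map counitHom (.id k (FreeHopfAlgebra k C))
            (TensorProduct.map (gen k C n) (gen k C n) z) =
          TensorProduct.map (Coalgebra.counit (R := k)) (gen k C n) z := by
        intro z
        induction z with
        | zero => simp
        | add x y hx hy => simp only [map_add, hx, hy]
        | tmul x y => simp [counitHom_gen]
      rw [e, map_counit]
      simp)
    (by
      apply algHom_ext
      intro n c
      rw [AlgHom.comp_apply, comulHom_gen]
      have e : ∀ z : C ⊗[k] C,
          Algebra.TensorProduct.map (.id k (FreeHopfAlgebra k C)) counitHom
            (TensorProduct.map (gen k C n) (gen k C n) z) =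
          TensorProduct.map (gen k C n) (Coalgebra.counit (R := k)) z := by
        intro z
        induction z with
        | zero => simp
        | add x y hx hy => simp only [map_add, hx, hy]
        | tmul x y => simp [counitHom_gen]
      rw [e, map_counit']
      simp)

theorem comul_gen (n : ℕ) (c : C) : Coalgebra.comul (R := k) (gen k C n c) =
    TensorProduct.map (gen k C n) (gen k C n) (twistedComul k C n c) :=
  comulHom_gen n c

theorem counit_gen (n : ℕ) (c : C) :
    Coalgebra.counit (R := k) (gen k C n c) = Coalgebra.counit (R := k) c :=
  counitHom_gen n c

theorem conv_op {A : Type*} [Ring A] [Algebra k A] (n : ℕ) {f g : C →ₗ[k] A}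
    (h : conv (n + 1) f * conv (n + 1) g = 1) :
    conv n ((MulOpposite.opLinearEquiv k).toLinearMap ∘ₗ g) *
      conv n ((MulOpposite.opLinearEquiv k).toLinearMap ∘ₗ f) = 1 := by
  rw [conv_mul_eq_one_iff] at h ⊢
  intro c
  rw [MulOpposite.algebraMap_apply, ← h, twistedComul_succ]
  generalize twistedComul k C n c = z
  induction z with
  | zero => simp
  | add x y hx hy => simp only [map_add, hx, hy, MulOpposite.op_add]
  | tmul x y => simp

/-- The antipode as an algebra map to the opposite algebra. -/
noncomputable def antipodeHom : FreeHopfAlgebra k C →ₐ[k] (FreeHopfAlgebra k C)ᵐᵒᵖ :=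
  lift (fun n => (MulOpposite.opLinearEquiv k).toLinearMap ∘ₗ gen k C (n + 1))
    (fun n => conv_op n (gen_left k C (n + 1))) (fun n => conv_op n (gen_right k C (n + 1)))

/-- The antipode, moving the `n`-th copy of `C` identically onto the `(n+1)`-st. -/
noncomputable def antipodeMap : FreeHopfAlgebra k C →ₗ[k] FreeHopfAlgebra k C :=
  (MulOpposite.opLinearEquiv k).symm.toLinearMap ∘ₗ antipodeHom.toLinearMap

theorem antipodeMap_gen (n : ℕ) (c : C) : antipodeMap (gen k C n c) = gen k C (n + 1) c := by
  simp [antipodeMap, antipodeHom]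

theorem antipodeMap_mul (x y : FreeHopfAlgebra k C) :
    antipodeMap (x * y) = antipodeMap y * antipodeMap x := by
  simp [antipodeMap]

theorem antipodeMap_one : antipodeMap (1 : FreeHopfAlgebra k C) = 1 := by
  simp [antipodeMap]

theorem antipodeMap_algebraMap (r : k) :
    antipodeMap (algebraMap k (FreeHopfAlgebra k C) r) = algebraMap k _ r := by
  simp [antipodeMap]

open WithConv Coalgebra in
theorem antipodeMap_conv_id :
    toConv (antipodeMap (k := k) (C := C)) * toConv LinearMap.id = 1 := by
  ext x
  change LinearMap.mul' k _ (TensorProduct.map antipodeMap LinearMap.id (comul (R := k) x)) =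
    algebraMap k _ (counit (R := k) x)
  induction x using induction_on with
  | halg r => simp [Algebra.TensorProduct.algebraMap_apply, antipodeMap_algebraMap]
  | hgen n c =>
    rw [comul_gen, counit_gen, ← (conv_mul_eq_one_iff n _ _).1 (gen_left k C n) c]
    generalize twistedComul k C n c = z
    induction z with
    | zero => simp
    | add x y hx hy => simp only [map_add, hx, hy]
    | tmul x y => simp [antipodeMap_gen]
  | hadd x y hx hy => simp only [map_add, hx, hy]
  | hmul x y hx hy =>
    rw [Bialgebra.comul_mul, Bialgebra.counit_mul, map_mul (algebraMap k _)]
    have e : ∀ u v : FreeHopfAlgebra k C ⊗[k] FreeHopfAlgebra k C,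
        LinearMap.mul' k _ (TensorProduct.map antipodeMap LinearMap.id (u * v)) =
        LinearMap.mul' k _ (TensorProduct.map antipodeMap
          (LinearMap.mulLeft k (LinearMap.mul' k _
            (TensorProduct.map antipodeMap LinearMap.id u))) v) := by
      intro u v
      induction v with
      | zero => simp
      | add a b ha hb => simp only [mul_add, map_add, ha, hb]
      | tmul a b =>
        induction u with
        | zero => simp
        | add c d hc hd =>
          simp only [TensorProduct.map_tmul, LinearMap.mul'_apply, LinearMap.mulLeft_apply,
            map_add, add_mul, mul_add] at hc hd ⊢
          rw [hc, hd]
        | tmul c d => simp [antipodeMap_mul, mul_assoc]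
    rw [e, hx]
    have e3 : ∀ (r : k) (v : FreeHopfAlgebra k C ⊗[k] FreeHopfAlgebra k C),
        LinearMap.mul' k _ (TensorProduct.map antipodeMap
          (LinearMap.mulLeft k (algebraMap k (FreeHopfAlgebra k C) r)) v) =
        algebraMap k (FreeHopfAlgebra k C) r *
          LinearMap.mul' k _ (TensorProduct.map antipodeMap LinearMap.id v) := by
      intro r v
      induction v with
      | zero => simp
      | add a b ha hb => simp only [mul_add, map_add, ha, hb]
      | tmul a b =>
        simp only [TensorProduct.map_tmul, LinearMap.mul'_apply, LinearMap.mulLeft_apply,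
          LinearMap.id_apply]
        rw [← mul_assoc, ← mul_assoc, Algebra.commutes]
    rw [e3, hy]

open WithConv Coalgebra in
theorem id_conv_antipodeMap :
    toConv LinearMap.id * toConv (antipodeMap (k := k) (C := C)) = 1 := by
  ext x
  change LinearMap.mul' k _ (TensorProduct.map LinearMap.id antipodeMap (comul (R := k) x)) =
    algebraMap k _ (counit (R := k) x)
  induction x using induction_on with
  | halg r => simp [Algebra.TensorProduct.algebraMap_apply, antipodeMap_one]
  | hgen n c =>
    rw [comul_gen, counit_gen, ← (conv_mul_eq_one_iff n _ _).1 (gen_right k C n) c]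
    generalize twistedComul k C n c = z
    induction z with
    | zero => simp
    | add x y hx hy => simp only [map_add, hx, hy]
    | tmul x y => simp [antipodeMap_gen]
  | hadd x y hx hy => simp only [map_add, hx, hy]
  | hmul x y hx hy =>
    rw [Bialgebra.comul_mul, Bialgebra.counit_mul, map_mul (algebraMap k _)]
    have e : ∀ u v : FreeHopfAlgebra k C ⊗[k] FreeHopfAlgebra k C,
        LinearMap.mul' k _ (TensorProduct.map LinearMap.id antipodeMap (u * v)) =
        LinearMap.mul' k _ (TensorProduct.map
          (LinearMap.mulRight k (LinearMap.mul' k _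
            (TensorProduct.map LinearMap.id antipodeMap v))) antipodeMap u) := by
      intro u v
      induction u with
      | zero => simp
      | add a b ha hb => simp only [add_mul, map_add, ha, hb]
      | tmul a b =>
        induction v with
        | zero => simp
        | add c d hc hd =>
          simp only [TensorProduct.map_tmul, LinearMap.mul'_apply, LinearMap.mulRight_apply,
            map_add, add_mul, mul_add] at hc hd ⊢
          rw [hc, hd]
        | tmul c d => simp [antipodeMap_mul, mul_assoc]
    rw [e, hy]
    have e3 : ∀ (r : k) (v : FreeHopfAlgebra k C ⊗[k] FreeHopfAlgebra k C),
        LinearMap.mul' k _ (TensorProduct.map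
          (LinearMap.mulRight k (algebraMap k (FreeHopfAlgebra k C) r)) antipodeMap v) =
          LinearMap.mul' k _ (TensorProduct.map LinearMap.id antipodeMap v) *
            algebraMap k (FreeHopfAlgebra k C) r := by
      intro r v
      induction v with
      | zero => simp
      | add a b ha hb => simp only [add_mul, map_add, ha, hb]
      | tmul a b =>
        simp only [TensorProduct.map_tmul, LinearMap.mul'_apply, LinearMap.mulRight_apply,
          LinearMap.id_apply]
        rw [mul_assoc, mul_assoc, Algebra.commutes]
    rw [e3, hx]

noncomputable instance instHopfAlgebra : HopfAlgebra k (FreeHopfAlgebra k C) :=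
  HopfAlgebra.ofConvInverse antipodeMap antipodeMap_conv_id id_conv_antipodeMap

theorem antipode_gen (n : ℕ) (c : C) :
    HopfAlgebra.antipode k (gen k C n c) = gen k C (n + 1) c :=
  antipodeMap_gen n c

variable (k C) in
/-- The structure map `C → H_f(C)` of the free Hopf algebra. -/
noncomputable def ι : C →ₗc[k] FreeHopfAlgebra k C where
  toLinearMap := gen k C 0
  counit_comp := by ext c; exact counit_gen 0 c
  map_comp_comul := by
    ext c
    have h := comul_gen (k := k) 0 c
    simp only [twistedComul, Even.zero, if_true] at h
    exact h.symm

section Universal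

variable {K : Type w} [Ring K] [HopfAlgebra k K]

open WithConv Coalgebra HopfAlgebra

theorem comul_antipode (x : K) : comul (R := k) (antipode k x) =
    TensorProduct.comm k K K (TensorProduct.map (antipode k) (antipode k) (comul (R := k) x)) := by
  let jL : K →ₐ[k] K ⊗[k] K := Algebra.TensorProduct.includeLeft
  let jR : K →ₐ[k] K ⊗[k] K := Algebra.TensorProduct.includeRight
  have cancel : ∀ j : K →ₐ[k] K ⊗[k] K,
      toConv (j.toLinearMap ∘ₗ antipode k) * toConv j.toLinearMap = 1 := by
    intro j
    have h := LinearMap.algHom_comp_convMul_distrib j (toConv (antipode k (A := K)))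
      (toConv LinearMap.id)
    rw [LinearMap.antipode_mul_id] at h
    apply WithConv.ext
    refine Eq.trans ?_ (h.symm.trans ?_)
    · rfl
    · ext y; simp
  have hΔ : toConv (comul (R := k) (A := K)) =
      toConv jL.toLinearMap * toConv jR.toLinearMap := by
    ext y
    change comul (R := k) y = LinearMap.mul' k _ (TensorProduct.map _ _ (comul (R := k) y))
    generalize comul (R := k) y = z
    induction z with
    | zero => simp
    | add x y hx hy => rw [map_add, map_add, ← hx, ← hy]
    | tmul x y => simp [jL, jR]
  have hleft : (toConv (jR.toLinearMap ∘ₗ antipode k) * toConv (jL.toLinearMap ∘ₗ antipode k)) *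
      toConv (comul (R := k) (A := K)) = 1 := by
    rw [hΔ, mul_assoc, ← mul_assoc (toConv (jL.toLinearMap ∘ₗ _)), cancel, one_mul, cancel]
  have h := left_inv_eq_right_inv hleft LinearMap.comul_right_inv
  have h2 := congrArg (fun z => z.ofConv x) h
  refine h2.symm.trans ?_
  change LinearMap.mul' k _ (TensorProduct.map _ _ (comul (R := k) x)) = _
  generalize comul (R := k) x = z
  induction z with
  | zero => simp
  | add x y hx hy => simp only [map_add, hx, hy]
  | tmul x y => simp [jL, jR]

theorem map_antipode {H : Type*} [Ring H] [HopfAlgebra k H] (φ : H →ₐc[k] K) (x : H) :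
    φ (antipode k x) = antipode k (φ x) := by
  have h1 : toConv ((φ : H →ₗ[k] K) ∘ₗ antipode k) * toConv (φ : H →ₗ[k] K) = 1 := by
    have h := LinearMap.algHom_comp_convMul_distrib (φ : H →ₐ[k] K) (toConv (antipode k (A := H)))
      (toConv LinearMap.id)
    rw [LinearMap.antipode_mul_id] at h
    apply WithConv.ext
    refine Eq.trans ?_ (h.symm.trans ?_)
    · rfl
    · ext y; exact AlgHom.commutes (φ : H →ₐ[k] K) _
  have h2 : toConv (φ : H →ₗ[k] K) * toConv (antipode k ∘ₗ (φ : H →ₗ[k] K)) = 1 := by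
    have h := LinearMap.convMul_comp_coalgHom_distrib (toConv LinearMap.id)
      (toConv (antipode k (A := K))) (φ : H →ₗc[k] K)
    rw [LinearMap.id_mul_antipode] at h
    apply WithConv.ext
    refine Eq.trans ?_ (h.symm.trans ?_)
    · rfl
    · ext y; simp
  exact congrArg (fun z => z.ofConv x) (left_inv_eq_right_inv h1 h2)

/-- The iterates `Sⁿ ∘ f`. -/
noncomputable def iterAntipode (f : C →ₗ[k] K) : ℕ → C →ₗ[k] K
  | 0 => f
  | n + 1 => antipode k ∘ₗ iterAntipode f n

theorem comul_iterAntipode (f : C →ₗc[k] K) (n : ℕ) (c : C) :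
    comul (R := k) (iterAntipode (f : C →ₗ[k] K) n c) =
      TensorProduct.map (iterAntipode (f : C →ₗ[k] K) n) (iterAntipode (f : C →ₗ[k] K) n)
        (twistedComul k C n c) := by
  induction n with
  | zero => simp [iterAntipode, twistedComul]
  | succ n ih =>
    rw [twistedComul_succ, iterAntipode, LinearMap.comp_apply, comul_antipode, ih]
    generalize twistedComul k C n c = z
    induction z with
    | zero => simp
    | add x y hx hy => simp only [map_add, hx, hy]
    | tmul x y => simp

theorem counit_iterAntipode (f : C →ₗc[k] K) (n : ℕ) (c : C) :
    counit (R := k) (iterAntipode (f : C →ₗ[k] K) n c) = counit (R := k) c := by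
  induction n with
  | zero => simp [iterAntipode]
  | succ n ih => simp [iterAntipode, ih]

theorem iterAntipode_right (f : C →ₗc[k] K) (n : ℕ) :
    conv n (iterAntipode (f : C →ₗ[k] K) n) * conv n (iterAntipode (f : C →ₗ[k] K) (n + 1)) =
      1 := by
  rw [conv_mul_eq_one_iff]
  intro c
  rw [← counit_iterAntipode f n c, ← mul_antipode_lTensor_comul_apply, comul_iterAntipode]
  generalize twistedComul k C n c = z
  induction z with
  | zero => simp
  | add x y hx hy => simp only [map_add, hx, hy]
  | tmul x y => simp [iterAntipode]

theorem iterAntipode_left (f : C →ₗc[k] K) (n : ℕ) :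
    conv n (iterAntipode (f : C →ₗ[k] K) (n + 1)) * conv n (iterAntipode (f : C →ₗ[k] K) n) =
      1 := by
  rw [conv_mul_eq_one_iff]
  intro c
  rw [← counit_iterAntipode f n c, ← mul_antipode_rTensor_comul_apply, comul_iterAntipode]
  generalize twistedComul k C n c = z
  induction z with
  | zero => simp
  | add x y hx hy => simp only [map_add, hx, hy]
  | tmul x y => simp [iterAntipode]

/-- The universal property: every coalgebra map from `C` to a Hopf algebra `K` factors uniquely
through a morphism of Hopf algebras `H_f(C) → K`. -/
theorem existsUnique_lift (f : C →ₗc[k] K) :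
    ∃! φ : FreeHopfAlgebra k C →ₐc[k] K, ∀ c : C, φ (ι k C c) = f c := by
  let φ₀ : FreeHopfAlgebra k C →ₐ[k] K :=
    lift (iterAntipode (f : C →ₗ[k] K)) (iterAntipode_right f) (iterAntipode_left f)
  have hφ₀ : ∀ n c, φ₀ (gen k C n c) = iterAntipode (f : C →ₗ[k] K) n c :=
    fun n c => lift_gen _ _ _ n c
  refine ⟨BialgHom.ofAlgHom φ₀ ?_ ?_, ?_, ?_⟩
  · apply algHom_ext
    intro n c
    simp only [AlgHom.comp_apply, hφ₀, Bialgebra.counitAlgHom_apply, counit_gen,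
      counit_iterAntipode]
  · apply algHom_ext
    intro n c
    simp only [AlgHom.comp_apply, hφ₀, Bialgebra.comulAlgHom_apply, comul_gen,
      comul_iterAntipode]
    generalize twistedComul k C n c = z
    induction z with
    | zero => simp
    | add x y hx hy => simp only [map_add, hx, hy]
    | tmul x y => simp [hφ₀]
  · intro c
    exact hφ₀ 0 c
  · intro ψ hψ
    have key : ∀ n c, ψ (gen k C n c) = iterAntipode (f : C →ₗ[k] K) n c := by
      intro n
      induction n with
      | zero => exact hψ
      | succ n ih =>
        intro c
        rw [← antipode_gen, map_antipode, ih]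
        rfl
    apply BialgHom.coe_toAlgHom_injective
    apply algHom_ext
    intro n c
    exact (key n c).trans (hφ₀ n c).symm

end Universal

end FreeHopfAlgebra
end Twist

section Pointed

variable (k : Type u) {C : Type v} [Field k] [AddCommGroup C] [Module k C] [Coalgebra k C]

/-- A subspace `D` is a subcoalgebra if `Δ(D) ⊆ D ⊗ D`. -/
def IsSubcoalgebra (D : Submodule k C) : Prop :=
  ∀ d ∈ D, Coalgebra.comul (R := k) d ∈ LinearMap.range (TensorProduct.map D.subtype D.subtype)

/-- A subcoalgebra is simple if it is nonzero and its only subcoalgebras are `0` and itself. -/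
def IsSimpleSubcoalgebra (D : Submodule k C) : Prop :=
  IsSubcoalgebra k D ∧ D ≠ ⊥ ∧ ∀ E : Submodule k C, IsSubcoalgebra k E → E ≤ D → E = ⊥ ∨ E = D

variable (C) in
/-- A coalgebra is pointed if all of its simple subcoalgebras are one-dimensional. -/
def IsPointedCoalgebra : Prop :=
  ∀ D : Submodule k C, IsSimpleSubcoalgebra k D → Module.finrank k D = 1

end Pointed

/-! Algebra maps from the free Hopf algebra to `A` are sequences of linear maps `f n : C → A` in
which `f n` and `f (n + 1)` are convolution inverse, for `Δ` when `n` is even and for the flipped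
`Δ` when `n` is odd. The question is whether finitely many terms always generate the later ones.

Over an algebraically closed field `E`, put `X = E ⊗ C`. The quotient of the dual algebra of `X` by
its radical is a product of matrix algebras, and the dual comatrix elements of `X` span its
coradical. Evaluation at them turns `f n` into square matrices and convolution into matrix
multiplication, of the transposes for odd `n`. The radical is nilpotent, so a map is convolution
invertible once its matrices are (`exists_conv_inverse`), and this can be done inside a prescribed
subalgebra (`exists_isConvInverse_mem`).

If `X` is pointed, the matrices are `1 × 1` and transposition does nothing. The matrices of `f (n +
2)` are then those of `f n`, and every term stays in the subalgebra generated by the first two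
(`chain_mem_of_dim_eq_one`). Faithful flatness descends this to `k`: `C` and `S(C)` generate.

If some block has size at least two, inverting alternately with and without transposition need not
be periodic over a noncommutative ring. For each `N`, `exists_twistInverse_chain` gives matrices
that lie in a subalgebra up to index `N` but not at `N + 1`. They come from six-vertex matrices,
regarded as `2 × 2` over `M₂(K)`: inversion and outer transposition preserve their shape, and the
recursion reduces to `h (n+1)² - e² = h n * h (n+2)`. This is solved by `h n = q⁻ⁿ x² - qⁿ` and `e =
x (q - q⁻¹)`, with `x` a power series chosen so that a single `h n` is a nonunit. Lifting the chain
to `X` contradicts generation by the terms up to `N`. -/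

section Matrices

/-! ### Twisted inverses and six-vertex matrices. -/

/-- `M` for even `n` and the transpose of `M` for odd `n`. -/
def twistMatrix {ι R : Type*} (n : ℕ) (M : Matrix ι ι R) : Matrix ι ι R :=
  if Even n then M else M.transpose

/-- `M` and `N` are mutually inverse, in the `n`-th twisted sense. -/
def IsTwistInverse {ι R : Type*} [Fintype ι] [DecidableEq ι] [Semiring R] (n : ℕ)
    (M N : Matrix ι ι R) : Prop :=
  twistMatrix n M * twistMatrix n N = 1 ∧ twistMatrix n N * twistMatrix n M = 1

theorem isTwistInverse_one {ι R : Type*} [Fintype ι] [DecidableEq ι] [Semiring R] (n : ℕ) :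
    IsTwistInverse n (1 : Matrix ι ι R) 1 := by
  unfold IsTwistInverse twistMatrix
  split_ifs <;> simp

theorem isTwistInverse_pad {ι κ τ R : Type*} [Fintype ι] [DecidableEq ι] [Fintype κ]
    [DecidableEq κ] [Fintype τ] [DecidableEq τ] [Semiring R] {n : ℕ} {M N : Matrix ι ι R}
    (h : IsTwistInverse n M N) (e : τ ≃ ι ⊕ κ) :
    IsTwistInverse n ((Matrix.fromBlocks M 0 0 (1 : Matrix κ κ R)).submatrix e e)
      ((Matrix.fromBlocks N 0 0 (1 : Matrix κ κ R)).submatrix e e) := by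
  unfold IsTwistInverse twistMatrix at h ⊢
  split_ifs at h ⊢ with hn
  · simp [Matrix.submatrix_mul_equiv, Matrix.fromBlocks_multiply, h.1, h.2]
  · simp [Matrix.submatrix_mul_equiv, Matrix.fromBlocks_multiply, h.1, h.2,
      Matrix.fromBlocks_transpose]

/-- The `4 × 4` matrices of six-vertex type, as `2 × 2` matrices of `2 × 2` matrices. -/
def sixVertex {K : Type*} [Zero K] (a b c : K) : Matrix (Fin 2) (Fin 2) (Matrix (Fin 2) (Fin 2) K) :=
  !![!![a, 0; 0, b], !![0, 0; c, 0]; !![0, c; 0, 0], !![b, 0; 0, a]]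

/-- On pairs (outer index, inner index), the matrix is `a` on `(0,0)` and `(1,1)`, and the symmetric
block with diagonal `b` and off-diagonal `c` on the span of `(0,1)` and `(1,0)`. The hypotheses say
that these blocks are inverse. -/
theorem sixVertex_mul {K : Type*} [Field K] {a b c a' b' c' : K} (h1 : a * a' = 1)
    (h2 : b * b' + c * c' = 1) (h3 : b * c' + c * b' = 0) :
    sixVertex a b c * sixVertex a' b' c' = 1 := by
  ext i j α β
  have h2' : c * c' + b * b' = 1 := by rw [add_comm, h2]
  have h3' : c * b' + b * c' = 0 := by rw [add_comm, h3]
  fin_cases i <;> fin_cases j <;> fin_cases α <;> fin_cases β <;>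
    simp [sixVertex, Matrix.mul_apply, Fin.sum_univ_two, *]

/-- Transposition acts on the outer index only. It moves `c` to the span of `(0,0)` and `(1,1)`, so
`a` and `b` exchange their roles. -/
theorem sixVertex_transpose_mul {K : Type*} [Field K] {a b c a' b' c' : K} (h1 : b * b' = 1)
    (h2 : a * a' + c * c' = 1) (h3 : a * c' + c * a' = 0) :
    (sixVertex a b c).transpose * (sixVertex a' b' c').transpose = 1 := by
  ext i j α β
  have h2' : c * c' + a * a' = 1 := by rw [add_comm, h2]
  have h3' : c * a' + a * c' = 0 := by rw [add_comm, h3]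
  fin_cases i <;> fin_cases j <;> fin_cases α <;> fin_cases β <;>
    simp [sixVertex, Matrix.mul_apply, Fin.sum_univ_two, *]

/-- The normalizing scalars of `sixVertexChain`. -/
def chainScalar {K : Type*} [Field K] (h : ℕ → K) : ℕ → K
  | 0 => 1
  | n + 1 => (chainScalar h n * h n * h (n + 2))⁻¹

/-- A sequence of matrices, each the inverse of its predecessor, alternately for the usual and
for the transposed multiplication. -/
def sixVertexChain {K : Type*} [Field K] (h : ℕ → K) (e : K) (n : ℕ) :
    Matrix (Fin 2) (Fin 2) (Matrix (Fin 2) (Fin 2) K) :=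
  let μ := chainScalar h n
  if Even n then sixVertex (μ * h n) (μ * h (n + 1)) (μ * e)
  else sixVertex (μ * h (n + 1)) (μ * h n) (-(μ * e))

theorem chainScalar_ne_zero {K : Type*} [Field K] {h : ℕ → K} (hh : ∀ n, h n ≠ 0) (n : ℕ) :
    chainScalar h n ≠ 0 := by
  induction n with
  | zero => exact one_ne_zero
  | succ n ih => exact inv_ne_zero (mul_ne_zero (mul_ne_zero ih (hh n)) (hh _))

theorem sixVertexChain_isTwistInverse {K : Type*} [Field K] {h : ℕ → K} {e : K}
    (hh : ∀ n, h n ≠ 0) (he : ∀ n, h (n + 1) ^ 2 - e ^ 2 = h n * h (n + 2)) (n : ℕ) :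
    IsTwistInverse n (sixVertexChain h e n) (sixVertexChain h e (n + 1)) := by
  have hμ := chainScalar_ne_zero hh n
  have h0 := hh n
  have h2 := hh (n + 2)
  have he' := he n
  -- These are the conditions on the `1 × 1` and `2 × 2` blocks. The scalar is normalized to give
  -- the first; the recursion `he` then gives the second.
  have e1 : chainScalar h n * h n * (chainScalar h (n + 1) * h (n + 2)) = 1 := by
    rw [chainScalar]; field_simp
  have e2 : chainScalar h n * h (n + 1) * (chainScalar h (n + 1) * h (n + 1)) -
      chainScalar h n * e * (chainScalar h (n + 1) * e) = 1 := by
    rw [chainScalar]; field_simp; linear_combination he'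
  unfold IsTwistInverse twistMatrix sixVertexChain
  by_cases hn : Even n
  · simp only [hn, Nat.even_add_one, not_true, if_true, if_false]
    constructor <;> apply sixVertex_mul <;> first | linear_combination e1 | linear_combination e2 | ring
  · simp only [hn, Nat.even_add_one, not_false_iff, if_true, if_false]
    constructor <;> apply sixVertex_transpose_mul <;>
      first | linear_combination e1 | linear_combination e2 | ring

end Matrices

/-! ### Six-vertex weights over a power series ring, and chains leaving a subalgebra. -/

section Matrices

theorem exists_field_injective_pow (E : Type u) [Field E] :
    ∃ (F : Type u) (_ : Field F) (_ : Algebra E F) (q : F),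
      q ≠ 0 ∧ Function.Injective (fun n : ℕ => q ^ n) := by
  refine ⟨RatFunc E, inferInstance, inferInstance, RatFunc.X, RatFunc.X_ne_zero, ?_⟩
  intro m n h
  simp only [← RatFunc.algebraMap_X, ← map_pow] at h
  have := congrArg Polynomial.natDegree (RatFunc.algebraMap_injective E h)
  simpa using this

open PowerSeries in
/-- Sequences for `sixVertexChain` that are units of a local ring up to a prescribed index, where
they are not. -/
theorem exists_sixVertex_sequence (E : Type u) [Field E] (N : ℕ) :
    ∃ (K : Type u) (_ : Field K) (_ : Algebra E K) (O : Subalgebra E K) (h : ℕ → K) (e : K),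
      (∀ n, h n ≠ 0) ∧ (∀ n, h (n + 1) ^ 2 - e ^ 2 = h n * h (n + 2)) ∧ e ∈ O ∧
      (∀ n, h n ∈ O) ∧ (∀ n < N, (h n)⁻¹ ∈ O) ∧ (h N)⁻¹ ∉ O := by
  obtain ⟨F, _, _, q, hq, hinj⟩ := exists_field_injective_pow E
  let K := FractionRing F⟦X⟧
  let f : F⟦X⟧ →ₐ[E] K := IsScalarTower.toAlgHom E F⟦X⟧ K
  have hf : Function.Injective f := IsFractionRing.injective F⟦X⟧ K
  -- The constant term makes `p N` vanish at `X = 0`, and only `p N`, since the powers of `q` are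
  -- distinct. The summand `X` keeps `p N` itself nonzero.
  let x : F⟦X⟧ := C (q ^ N) + X
  let p : ℕ → F⟦X⟧ := fun n => C (q ^ n)⁻¹ * x ^ 2 - C (q ^ n)
  have hx : ∀ a : F, coeff 2 (C a * x ^ 2) = a := by
    intro a
    have : x ^ 2 = C ((q ^ N) ^ 2) + C (2 * q ^ N) * X + X ^ 2 := by
      simp only [x, map_mul, map_pow, map_ofNat]; ring
    rw [coeff_C_mul, this, map_add, map_add, coeff_C, coeff_C_mul, coeff_X, coeff_X_pow]
    simp
  have hp0 : ∀ n, p n ≠ 0 := by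
    intro n h
    have := congrArg (coeff 2) h
    rw [map_sub, hx, coeff_C, if_neg two_ne_zero, sub_zero, map_zero] at this
    exact inv_ne_zero (pow_ne_zero n hq) this
  have hpc : ∀ n, constantCoeff (p n) = (q ^ n)⁻¹ * (q ^ N) ^ 2 - q ^ n := by
    intro n; simp [p, x]
  have hunit : ∀ n, n ≠ N → IsUnit (p n) := by
    intro n hn
    rw [PowerSeries.isUnit_iff_constantCoeff, isUnit_iff_ne_zero, hpc]
    intro h
    have : q ^ (2 * N) = q ^ (2 * n) := by
      have hn0 := pow_ne_zero n hq
      field_simp at h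
      linear_combination h
    have := hinj this
    omega
  have hnon : ¬ IsUnit (p N) := by
    rw [PowerSeries.isUnit_iff_constantCoeff, isUnit_iff_ne_zero, hpc]
    have hN0 := pow_ne_zero N hq
    rw [ne_eq, not_not, pow_two, inv_mul_cancel_left₀ hN0, sub_self]
  refine ⟨K, inferInstance, inferInstance, f.range, fun n => f (p n),
    f (x * (C q - C q⁻¹)), ?_, ?_, ⟨_, rfl⟩, fun n => ⟨_, rfl⟩, ?_, ?_⟩
  · intro n h
    exact hp0 n (hf (h.trans (map_zero f).symm))
  · intro n
    rw [← map_pow, ← map_pow, ← map_sub, ← map_mul]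
    congr 1
    have h1 : (C q : F⟦X⟧) * C q⁻¹ = 1 := by rw [← map_mul, mul_inv_cancel₀ hq, map_one]
    have h2 : (C q : F⟦X⟧) ^ n * (C q⁻¹) ^ n = 1 := by rw [← mul_pow, h1, one_pow]
    -- What remains is a polynomial identity modulo `q q⁻¹ = 1` and `qⁿ q⁻ⁿ = 1`.
    simp only [p, ← inv_pow, map_pow]
    generalize (C q : F⟦X⟧) = a at *
    generalize (C q⁻¹ : F⟦X⟧) = b at *
    simp only [pow_succ, pow_zero, one_mul]
    generalize a ^ n = c at *
    generalize b ^ n = d at *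
    linear_combination (-2 * x * x * c * d + 2 * x * x) * h1 + (- 2 * x * x + x * x * (a * a + b * b)) * h2
  · intro n hn
    obtain ⟨y, hy⟩ := isUnit_iff_exists_inv.1 (hunit n hn.ne)
    refine ⟨y, ?_⟩
    apply eq_inv_of_mul_eq_one_right
    change f (p n) * f y = 1
    rw [← map_mul, hy, map_one]
  · rintro ⟨y, hy⟩
    apply hnon
    refine IsUnit.of_mul_eq_one y (hf ?_)
    change f y = _ at hy
    rw [map_mul, hy, map_one, mul_inv_cancel₀]
    exact fun h => hp0 N (hf (h.trans (map_zero f).symm))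

/-- The scalar of index `n + 1` involves the inverses of `h n` and `h (n + 2)`, so scalars up to `N`
need units only below `N + 2`. -/
theorem chainScalar_mem {K E : Type*} [Field E] [Field K] [Algebra E K] {O : Subalgebra E K}
    {h : ℕ → K} (hO : ∀ n, h n ∈ O) {N : ℕ} (hN : ∀ n < N + 2, (h n)⁻¹ ∈ O) :
    ∀ n ≤ N, chainScalar h n ∈ O ∧ (chainScalar h n)⁻¹ ∈ O := by
  intro n
  induction n with
  | zero => intro _; simp [chainScalar, O.one_mem]
  | succ n ih =>
    intro hn
    obtain ⟨h1, h2⟩ := ih (by omega)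
    rw [chainScalar, inv_inv, mul_inv, mul_inv]
    exact ⟨O.mul_mem (O.mul_mem h2 (hN _ (by omega))) (hN _ (by omega)),
      O.mul_mem (O.mul_mem h1 (hO _)) (hO _)⟩

/-- For every `N` there is a chain of twisted inverses over an algebra `R` that stays in a
subalgebra precisely up to the index `N`. -/
theorem exists_twistInverse_chain (E : Type u) [Field E] (N : ℕ) {d : ℕ} (hd : 2 ≤ d) :
    ∃ (R : Type u) (_ : Ring R) (_ : Algebra E R) (S : Subalgebra E R)
      (t : ℕ → Matrix (Fin d) (Fin d) R),
      (∀ n, IsTwistInverse n (t n) (t (n + 1))) ∧ (∀ n ≤ N, ∀ i j, t n i j ∈ S) ∧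
      ∃ i j, t (N + 1) i j ∉ S := by
  -- The nonunit is placed at `N + 2` because `(h (N + 2))⁻¹` first enters through the scalar of
  -- index `N + 1`.
  obtain ⟨K, _, _, O, h, e, h0, he, heO, hO, hinv, hnot⟩ := exists_sixVertex_sequence E (N + 2)
  obtain ⟨m, rfl⟩ := Nat.exists_eq_add_of_le hd
  let ε : Fin (2 + m) ≃ Fin 2 ⊕ Fin m := finSumFinEquiv.symm
  let S : Subalgebra E (Matrix (Fin 2) (Fin 2) K) := O.matrix
  have hS6 : ∀ a b c, a ∈ O → b ∈ O → c ∈ O → ∀ i j, sixVertex a b c i j ∈ S := by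
    intro a b c ha hb hc i j α β
    have := O.zero_mem
    fin_cases i <;> fin_cases j <;> fin_cases α <;> fin_cases β <;> simp [sixVertex, *]
  have hS : ∀ n ≤ N, ∀ i j, sixVertexChain h e n i j ∈ S := by
    intro n hn i j
    have hμ := (chainScalar_mem hO hinv n hn).1
    by_cases hn : Even n <;> simp only [sixVertexChain, hn, if_true, if_false]
    · exact hS6 _ _ _ (O.mul_mem hμ (hO _)) (O.mul_mem hμ (hO _)) (O.mul_mem hμ heO) i j
    · exact hS6 _ _ _ (O.mul_mem hμ (hO _)) (O.mul_mem hμ (hO _))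
        (O.neg_mem (O.mul_mem hμ heO)) i j
  refine ⟨Matrix (Fin 2) (Fin 2) K, inferInstance, inferInstance, S,
    fun n => (Matrix.fromBlocks (sixVertexChain h e n) 0 0 1).submatrix ε ε, ?_, ?_, ?_⟩
  · exact fun n => isTwistInverse_pad (sixVertexChain_isTwistInverse h0 he n) ε
  · intro n hn i j
    change Matrix.fromBlocks (sixVertexChain h e n) 0 0 1 (ε i) (ε j) ∈ S
    rcases ε i with a | a <;> rcases ε j with b | b
    · exact hS n hn a b
    · exact S.zero_mem
    · exact S.zero_mem
    · rw [Matrix.fromBlocks_apply₂₂, Matrix.one_apply]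
      split_ifs
      exacts [S.one_mem, S.zero_mem]
  · have key : ∀ i : Fin 2, sixVertexChain h e (N + 1) i i 0 0 = chainScalar h (N + 1) * h (N + 1) →
        ¬ sixVertexChain h e (N + 1) i i ∈ S := by
      intro i hi hmem
      have h1 := hmem 0 0
      rw [hi, chainScalar] at h1
      apply hnot
      -- Cancelling the factors that are units of `O` in the offending entry, and multiplying by `h
      -- N`, leaves `(h (N + 2))⁻¹`.
      have h2 := O.mul_mem (O.mul_mem h1 (hinv (N + 1) (by omega)))
        (O.mul_mem (chainScalar_mem hO hinv N le_rfl).1 (hO N))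
      convert h2 using 1
      have a1 := chainScalar_ne_zero h0 N
      have a2 := h0 N
      have a3 := h0 (N + 1)
      have a4 := h0 (N + 2)
      field_simp
    -- The weight `h (N + 1)` is the parameter `a` for even index and `b` for odd index; these head
    -- the first and second diagonal blocks respectively.
    by_cases hN : Even (N + 1)
    · refine ⟨ε.symm (.inl 0), ε.symm (.inl 0), ?_⟩
      simp only [Matrix.submatrix_apply, Equiv.apply_symm_apply, Matrix.fromBlocks_apply₁₁]
      exact key 0 (by simp [sixVertexChain, hN, sixVertex])
    · refine ⟨ε.symm (.inl 1), ε.symm (.inl 1), ?_⟩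
      simp only [Matrix.submatrix_apply, Equiv.apply_symm_apply, Matrix.fromBlocks_apply₁₁]
      exact key 1 (by simp [sixVertexChain, hN, sixVertex])

end Matrices

/-! ### Comatrix elements from the Wedderburn decomposition of the dual algebra. -/

section Comatrix

open WithConv

/-- A family of comatrix elements spanning the coradical of a coalgebra whose simple
subcoalgebras are split. -/
structure ComatrixSystem (E : Type u) (X : Type v) [Field E] [AddCommGroup X] [Module E X]
    [Coalgebra E X] where
  /-- the number of simple subcoalgebras -/
  size : ℕ
  /-- the sizes of the matrix coalgebras -/
  dim : Fin size → ℕ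
  dim_pos : ∀ i, 0 < dim i
  /-- the comatrix elements -/
  elt : ∀ i, Fin (dim i) → Fin (dim i) → X
  exists_functional : ∀ t : ∀ i, Matrix (Fin (dim i)) (Fin (dim i)) E,
    ∃ b : X →ₗ[E] E, ∀ i j l, b (elt i j l) = t i j l
  comul_elt : ∀ i j l, Coalgebra.comul (R := E) (elt i j l) = ∑ p, elt i j p ⊗ₜ[E] elt i p l
  counit_elt : ∀ i j l,
    Coalgebra.counit (R := E) (elt i j l) = (1 : Matrix (Fin (dim i)) (Fin (dim i)) E) j l
  /-- the annihilator of the comatrix elements in the dual algebra -/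
  radical : Ideal (WithConv (X →ₗ[E] E))
  isTwoSided_radical : radical.IsTwoSided
  mem_radical : ∀ b, b ∈ radical ↔ ∀ i j l, b.ofConv (elt i j l) = 0
  isNilpotent_radical : IsNilpotent radical

variable {E : Type u} {X : Type v} [Field E] [AddCommGroup X] [Module E X]

theorem tensor_ext_of_functionals [FiniteDimensional E X] {z w : X ⊗[E] X}
    (h : ∀ b b' : X →ₗ[E] E, LinearMap.mul' E E (TensorProduct.map b b' z) =
      LinearMap.mul' E E (TensorProduct.map b b' w)) : z = w := by
  let e := Module.finBasis E X
  have key : ∀ (z : X ⊗[E] X) (i j), (e.tensorProduct e).repr z (i, j) =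
      LinearMap.mul' E E (TensorProduct.map (e.coord i) (e.coord j) z) := by
    intro z i j
    induction z with
    | zero => simp
    | add x y hx hy => simp only [map_add, Finsupp.add_apply, hx, hy]
    | tmul x y => simp [mul_comm]
  apply (e.tensorProduct e).repr.injective
  ext ⟨i, j⟩
  rw [key, key, h]

variable [Coalgebra E X]

/-- Over an algebraically closed field the dual algebra modulo its radical is a product of full
matrix algebras. Its coordinate functions are elements of `X` by biduality; multiplicativity and
surjectivity of the projection become the comultiplication formula and linear independence. -/
theorem exists_comatrixSystem [IsAlgClosed E] [FiniteDimensional E X] :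
    Nonempty (ComatrixSystem E X) := by
  let B := WithConv (X →ₗ[E] E)
  have hB : Module.Finite E B := Module.Finite.equiv (WithConv.linearEquiv E _).symm
  have hA : IsArtinianRing B := IsArtinianRing.of_finite E B
  obtain ⟨n, d, hd, ⟨φ⟩⟩ :=
    IsSemisimpleRing.exists_algEquiv_pi_matrix_of_isAlgClosed E (B ⧸ Ring.jacobson B)
  let π : B →ₐ[E] Π i, Matrix (Fin (d i)) (Fin (d i)) E :=
    φ.toAlgHom.comp (Ideal.Quotient.mkₐ E (Ring.jacobson B))
  have hπ : Function.Surjective π :=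
    φ.surjective.comp (Ideal.Quotient.mkₐ_surjective E (Ring.jacobson B))
  let c : ∀ i, Fin (d i) → Fin (d i) → X := fun i j l =>
    (Module.evalEquiv E X).symm
      { toFun := fun b => π (toConv b) i j l
        map_add' := fun b b' => by rw [toConv_add, map_add]; rfl
        map_smul' := fun r b => by rw [toConv_smul, map_smul]; rfl }
  have hc : ∀ (b : B) i j l, b.ofConv (c i j l) = π b i j l := by
    intro b i j l
    exact Module.apply_evalEquiv_symm_apply E X b.ofConv _
  exact ⟨{
    size := n
    dim := d
    dim_pos := fun i => (hd i).pos
    elt := c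
    exists_functional := fun t => by
      obtain ⟨b, rfl⟩ := hπ t
      exact ⟨b.ofConv, hc b⟩
    comul_elt := fun i j l => by
      apply tensor_ext_of_functionals
      intro b b'
      have h := hc (toConv b * toConv b') i j l
      rw [LinearMap.convMul_apply, map_mul, Pi.mul_apply, Matrix.mul_apply] at h
      refine h.trans ?_
      rw [map_sum, map_sum]
      refine Finset.sum_congr rfl fun p _ => ?_
      rw [← hc, ← hc]
      simp
    counit_elt := fun i j l => by
      have h := hc 1 i j l
      rw [map_one] at h
      exact h
    radical := Ring.jacobson B
    isTwoSided_radical := inferInstance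
    mem_radical := fun b => by
      simp only [hc]
      rw [← Ideal.Quotient.eq_zero_iff_mem, ← φ.map_eq_zero_iff]
      constructor
      · intro h i j l
        exact congrFun (congrFun (congrFun h i) j) l
      · intro h
        funext i
        ext j l
        exact h i j l
    isNilpotent_radical := IsSemiprimaryRing.isNilpotent }⟩

end Comatrix

/-! ### Convolution invertibility detected on comatrix elements. -/

section Comatrix

open WithConv FreeHopfAlgebra

variable {E : Type u} {X : Type v} [Field E] [AddCommGroup X] [Module E X]

theorem map_smulRight_mul {R : Type w} [Ring R] [Algebra E R] (b b' : X →ₗ[E] E) (r r' : R)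
    (z : X ⊗[E] X) :
    LinearMap.mul' E R (TensorProduct.map (b.smulRight r) (b'.smulRight r') z) =
      LinearMap.mul' E E (TensorProduct.map b b' z) • (r * r') := by
  induction z with
  | zero => simp
  | add x y hx hy => simp only [map_add, add_smul, hx, hy]
  | tmul x y => simp [smul_smul, mul_comm]

variable [Coalgebra E X]

/-- Passing to the co-opposite reverses the product in the dual algebra but leaves the order in `R`
unchanged. -/
theorem conv_smulRight_mul {R : Type w} [Ring R] [Algebra E R] (n : ℕ) (b b' : X →ₗ[E] E)
    (r r' : R) : conv n (b.smulRight r) * conv n (b'.smulRight r') =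
      conv n ((if Even n then (toConv b * toConv b').ofConv
        else (toConv b' * toConv b).ofConv).smulRight (r * r')) := by
  apply WithConv.ext
  apply LinearMap.ext
  intro (x : X)
  rw [conv_mul_apply, map_smulRight_mul]
  change _ = (LinearMap.smulRight _ _ : X →ₗ[E] R) x
  rw [LinearMap.smulRight_apply]
  unfold twistedComul
  split_ifs
  · rfl
  · rw [LinearMap.comp_apply, LinearEquiv.coe_coe, TensorProduct.map_comm, LinearMap.mul'_comm]
    rfl

theorem conv_smulRight_one {R : Type w} [Ring R] [Algebra E R] (n : ℕ) :
    conv n ((Coalgebra.counit (R := E) (A := X)).smulRight (1 : R)) = 1 := by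
  apply WithConv.ext
  apply LinearMap.ext
  intro (x : X)
  exact (Algebra.algebraMap_eq_smul_one _).symm

theorem twistMatrix_injective {ι R : Type*} (n : ℕ) :
    Function.Injective (twistMatrix n : Matrix ι ι R → Matrix ι ι R) := by
  intro M N h
  unfold twistMatrix at h
  split_ifs at h
  · exact h
  · exact Matrix.transpose_injective h

namespace ComatrixSystem

variable (S : ComatrixSystem E X) {R : Type w} [Ring R] [Algebra E R]

/-- The matrices of values of a linear map at the comatrix elements. -/
def values (f : X →ₗ[E] R) (i : Fin S.size) : Matrix (Fin (S.dim i)) (Fin (S.dim i)) R :=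
  Matrix.of fun j l => f (S.elt i j l)

theorem exists_dual (x : (i : Fin S.size) × Fin (S.dim i) × Fin (S.dim i)) : ∃ b : X →ₗ[E] E,
    ∀ i j l, b (S.elt i j l) =
      if (⟨i, j, l⟩ : (i : Fin S.size) × Fin (S.dim i) × Fin (S.dim i)) = x then 1 else 0 :=
  S.exists_functional fun _ _ _ => _

theorem exists_values_eq (t : ∀ i, Matrix (Fin (S.dim i)) (Fin (S.dim i)) R) :
    ∃ f : X →ₗ[E] R, S.values f = t := by
  choose b hb using S.exists_dual
  refine ⟨∑ x, (b x).smulRight (t x.1 x.2.1 x.2.2), ?_⟩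
  funext i
  ext j l
  simp only [values, Matrix.of_apply, LinearMap.sum_apply, LinearMap.smulRight_apply, hb, ite_smul,
    one_smul, zero_smul, Finset.sum_ite_eq, Finset.mem_univ, if_true]

theorem values_conv_mul (n : ℕ) (f g : X →ₗ[E] R) (i : Fin S.size) :
    twistMatrix n (S.values ((conv n f * conv n g).ofConv : X →ₗ[E] R) i) =
      twistMatrix n (S.values f i) * twistMatrix n (S.values g i) := by
  have h : ∀ j l, S.values ((conv n f * conv n g).ofConv : X →ₗ[E] R) i j l =
      LinearMap.mul' E R (TensorProduct.map f g (twistedComul E X n (S.elt i j l))) :=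
    fun j l => rfl
  unfold twistMatrix
  split_ifs with hn <;> ext j l
  · rw [h, Matrix.mul_apply, twistedComul, if_pos hn, S.comul_elt]
    simp [values]
  · rw [Matrix.transpose_apply, h, Matrix.mul_apply, twistedComul, if_neg hn, LinearMap.comp_apply,
      S.comul_elt]
    simp [values]

theorem values_one (n : ℕ) (i : Fin S.size) :
    twistMatrix n (S.values ((1 : WithConv (IterCop X n →ₗ[E] R)).ofConv : X →ₗ[E] R) i) = 1 := by
  have h : S.values ((1 : WithConv (IterCop X n →ₗ[E] R)).ofConv : X →ₗ[E] R) i = 1 := by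
    ext j l
    change algebraMap E R (Coalgebra.counit (R := E) (S.elt i j l)) = _
    rw [S.counit_elt, Matrix.one_apply, Matrix.one_apply]
    split_ifs <;> simp
  rw [h]
  unfold twistMatrix
  split_ifs <;> simp

/-- A map killing the comatrix elements is a finite sum of terms `b ⊗ r` with `b` in the radical,
and products of such terms multiply their functionals. -/
theorem exists_pow_mem (n : ℕ) {f : X →ₗ[E] R} [FiniteDimensional E X]
    (hf : ∀ i j l, f (S.elt i j l) = 0) (m : ℕ) :
    conv n f ^ m ∈ AddSubmonoid.closure
      {F | ∃ (b : X →ₗ[E] E) (r : R), toConv b ∈ S.radical ^ m ∧ F = conv n (b.smulRight r)} := by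
  have h1 : conv n f ∈ AddSubmonoid.closure
      {F | ∃ (b : X →ₗ[E] E) (r : R), toConv b ∈ S.radical ∧ F = conv n (b.smulRight r)} := by
    let D : Submodule E X := LinearMap.ker f
    obtain ⟨D', hD⟩ := D.exists_isCompl
    -- Since `p` kills `ker f`, its coordinates kill the comatrix elements, while `f ∘ p = f`.
    let p : X →ₗ[E] X := LinearMap.id - D.projection D' hD
    let e := Module.finBasis E X
    have hfp : f = ∑ s, ((e.coord s) ∘ₗ p).smulRight (f (e s)) := by
      ext x
      have h2 : f (p x) = f x := by
        have : f (D.projection D' hD x) = 0 := by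
          have := Submodule.projection_apply_mem hD x
          exact this
        simp [p, this]
      conv_lhs => rw [← h2, ← e.sum_repr (p x), map_sum]
      simp
    have hsum : conv n f = ∑ s, conv n (((e.coord s) ∘ₗ p).smulRight (f (e s))) := by
      conv_lhs => rw [hfp]
      exact toConv_sum _ _
    rw [hsum]
    refine AddSubmonoid.sum_mem _ fun s _ => AddSubmonoid.subset_closure ⟨_, _, ?_, rfl⟩
    rw [S.mem_radical]
    intro i j l
    have hx : S.elt i j l ∈ D := hf i j l
    have : p (S.elt i j l) = 0 := by
      simp only [p, LinearMap.sub_apply, LinearMap.id_apply]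
      rw [Submodule.projection_apply_of_mem_left hD hx, sub_self]
    simp [this]
  induction m with
  | zero =>
    refine AddSubmonoid.subset_closure ⟨_, 1, ?_, (conv_smulRight_one n).symm⟩
    rw [Submodule.pow_zero, Ideal.one_eq_top]
    trivial
  | succ m ih =>
    have := S.isTwoSided_radical
    have h := AddSubmonoid.mul_mem_mul ih h1
    rw [AddSubmonoid.closure_mul_closure, ← pow_succ] at h
    refine AddSubmonoid.closure_mono ?_ h
    rintro _ ⟨_, ⟨b, r, hb, rfl⟩, _, ⟨b', r', hb', rfl⟩, rfl⟩
    refine ⟨_, _, ?_, conv_smulRight_mul n b b' r r'⟩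
    -- For odd `n` the new factor appears on the left, which is where two-sidedness of the radical
    -- is needed.
    split_ifs
    · rw [Submodule.pow_succ]
      exact Ideal.mul_mem_mul hb hb'
    · rw [Ideal.IsTwoSided.pow_succ]
      exact Ideal.mul_mem_mul hb' hb

theorem isNilpotent_conv (n : ℕ) {f : X →ₗ[E] R} [FiniteDimensional E X]
    (hf : ∀ i j l, f (S.elt i j l) = 0) : IsNilpotent (conv n f) := by
  obtain ⟨m, hm⟩ := S.isNilpotent_radical
  refine ⟨m, ?_⟩
  have h := S.exists_pow_mem n hf m
  rw [hm] at h
  refine (AddSubmonoid.closure_le (S := ⊥)).2 ?_ h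
  rintro _ ⟨b, r, hb, rfl⟩
  have hb' : b = 0 := congrArg WithConv.ofConv (Ideal.mem_bot.1 hb)
  subst hb'
  rw [LinearMap.zero_smulRight]
  rfl

/-- A linear map whose values at the comatrix elements are invertible is convolution
invertible. -/
theorem exists_conv_inverse [FiniteDimensional E X] (n : ℕ) (f : X →ₗ[E] R)
    (t : ∀ i, Matrix (Fin (S.dim i)) (Fin (S.dim i)) R)
    (h : ∀ i, IsTwistInverse n (S.values f i) (t i)) :
    ∃ g : X →ₗ[E] R, conv n f * conv n g = 1 ∧ conv n g * conv n f = 1 ∧ S.values g = t := by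
  have unit_of : ∀ a : WithConv (IterCop X n →ₗ[E] R),
      (∀ i, twistMatrix n (S.values (a.ofConv : X →ₗ[E] R) i) = 1) → IsUnit a := by
    intro a ha
    have hn : IsNilpotent (1 - a) := by
      refine S.isNilpotent_conv n (f := ((1 - a).ofConv : X →ₗ[E] R)) fun i j l => ?_
      have h1 : S.values (a.ofConv : X →ₗ[E] R) i =
          S.values ((1 : WithConv (IterCop X n →ₗ[E] R)).ofConv : X →ₗ[E] R) i :=
        twistMatrix_injective n ((ha i).trans (S.values_one n i).symm)
      have h2 := congrFun (congrFun h1 j) l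
      exact sub_eq_zero.2 h2.symm
    simpa using hn.isUnit_one_sub
  -- Any `g₀` with the right matrices is an inverse up to a nilpotent error on each side; correcting
  -- each side by a unit gives one-sided inverses, which must agree.
  obtain ⟨g₀, rfl⟩ := S.exists_values_eq t
  have hu : IsUnit (conv n f * conv n g₀) :=
    unit_of _ fun i => by rw [values_conv_mul, (h i).1]
  have hv : IsUnit (conv n g₀ * conv n f) :=
    unit_of _ fun i => by rw [values_conv_mul, (h i).2]
  obtain ⟨a, ha⟩ := hu.exists_right_inv
  obtain ⟨b, hb⟩ := hv.exists_left_inv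
  rw [mul_assoc] at ha
  rw [← mul_assoc] at hb
  have hab := left_inv_eq_right_inv hb ha
  refine ⟨((conv n g₀ * a).ofConv : X →ₗ[E] R), ha, ?_, ?_⟩
  · change conv n g₀ * a * conv n f = 1
    rw [← hab, hb]
  · funext i
    apply twistMatrix_injective n
    refine (left_inv_eq_right_inv (h i).2 ?_).symm
    refine (S.values_conv_mul n f ((conv n g₀ * a).ofConv : X →ₗ[E] R) i).symm.trans ?_
    change twistMatrix n (S.values ((conv n f * (conv n g₀ * a)).ofConv : X →ₗ[E] R) i) = 1
    rw [ha, values_one]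

end ComatrixSystem

end Comatrix

/-! ### Pointedness in terms of the block sizes. -/

section Pointed

open WithConv FreeHopfAlgebra

variable {E : Type u} {X : Type v} [Field E] [AddCommGroup X] [Module E X]

theorem tmul_mem_range_map_subtype {D : Submodule E X} {x y : X} (hx : x ∈ D) (hy : y ∈ D) :
    x ⊗ₜ[E] y ∈ LinearMap.range (TensorProduct.map D.subtype D.subtype) :=
  ⟨⟨x, hx⟩ ⊗ₜ ⟨y, hy⟩, rfl⟩

variable [Coalgebra E X]

theorem IsSubcoalgebra.contract_left_mem {D : Submodule E X} (hD : IsSubcoalgebra E D) {x : X}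
    (hx : x ∈ D) (b : X →ₗ[E] E) :
    TensorProduct.lid E X (b.rTensor X (Coalgebra.comul (R := E) x)) ∈ D := by
  obtain ⟨w, hw⟩ := hD x hx
  rw [← hw]
  clear hw
  induction w with
  | zero => simp
  | add x y hx hy => simpa only [map_add] using D.add_mem hx hy
  | tmul x y => simpa using D.smul_mem _ y.2

theorem IsSubcoalgebra.contract_right_mem {D : Submodule E X} (hD : IsSubcoalgebra E D) {x : X}
    (hx : x ∈ D) (b : X →ₗ[E] E) :
    TensorProduct.rid E X (b.lTensor X (Coalgebra.comul (R := E) x)) ∈ D := by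
  obtain ⟨w, hw⟩ := hD x hx
  rw [← hw]
  clear hw
  induction w with
  | zero => simp
  | add x y hx hy => simpa only [map_add] using D.add_mem hx hy
  | tmul x y => simpa using D.smul_mem _ x.2

theorem IsSubcoalgebra.mul'_map_congr {D : Submodule E X} (hD : IsSubcoalgebra E D)
    {f g f' g' : X →ₗ[E] E} (hf : ∀ x ∈ D, f x = f' x) (hg : ∀ x ∈ D, g x = g' x) {x : X}
    (hx : x ∈ D) :
    LinearMap.mul' E E (TensorProduct.map f g (Coalgebra.comul (R := E) x)) =
      LinearMap.mul' E E (TensorProduct.map f' g' (Coalgebra.comul (R := E) x)) := by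
  obtain ⟨w, hw⟩ := hD x hx
  rw [← hw]
  clear hw
  induction w with
  | zero => simp
  | add x y hx hy => simp only [map_add, hx, hy]
  | tmul x y => simp [hf x x.2, hg y y.2]

theorem isSubcoalgebra_span {s : Set X}
    (hs : ∀ x ∈ s, Coalgebra.comul (R := E) x ∈ LinearMap.range
      (TensorProduct.map (Submodule.span E s).subtype (Submodule.span E s).subtype)) :
    IsSubcoalgebra E (Submodule.span E s) := by
  intro x hx
  have : Submodule.span E s ≤ (LinearMap.range
      (TensorProduct.map (Submodule.span E s).subtype (Submodule.span E s).subtype)).comap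
        (Coalgebra.comul (R := E)) := Submodule.span_le.2 hs
  exact this hx

namespace ComatrixSystem

variable (S : ComatrixSystem E X)

theorem elt_ne_zero (i : Fin S.size) (j l : Fin (S.dim i)) : S.elt i j l ≠ 0 := by
  intro h
  obtain ⟨b, hb⟩ := S.exists_dual ⟨i, j, l⟩
  have := hb i j l
  simp [h] at this

/-- Contracting `Δ` on the left and on the right with dual functionals acts like multiplication by
matrix units: from one nonzero coefficient of an element of `D`, every comatrix element of the block
is recovered. -/
theorem isSimpleSubcoalgebra_span (i : Fin S.size) :
    IsSimpleSubcoalgebra E (Submodule.span E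
      (Set.range fun p : Fin (S.dim i) × Fin (S.dim i) => S.elt i p.1 p.2)) := by
  have hmem : ∀ j l, S.elt i j l ∈ Submodule.span E
      (Set.range fun p : Fin (S.dim i) × Fin (S.dim i) => S.elt i p.1 p.2) :=
    fun j l => Submodule.subset_span ⟨(j, l), rfl⟩
  refine ⟨isSubcoalgebra_span ?_, ?_, ?_⟩
  · rintro _ ⟨⟨j, l⟩, rfl⟩
    dsimp only
    rw [S.comul_elt]
    exact Submodule.sum_mem _ fun p _ => tmul_mem_range_map_subtype (hmem _ _) (hmem _ _)
  · intro h
    have := hmem ⟨0, S.dim_pos i⟩ ⟨0, S.dim_pos i⟩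
    rw [h, Submodule.mem_bot] at this
    exact S.elt_ne_zero _ _ _ this
  · intro D hD hle
    refine or_iff_not_imp_left.2 fun hne => le_antisymm hle (Submodule.span_le.2 ?_)
    rintro _ ⟨⟨p, q⟩, rfl⟩
    obtain ⟨x, hx, hx0⟩ := D.ne_bot_iff.1 hne
    obtain ⟨α, rfl⟩ := (Submodule.mem_span_range_iff_exists_fun E).1 (hle hx)
    obtain ⟨⟨j₀, l₀⟩, hα⟩ : ∃ s, α s ≠ 0 := by
      by_contra! h
      exact hx0 (by simp [h])
    obtain ⟨b, hb⟩ := S.exists_dual ⟨i, j₀, p⟩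
    obtain ⟨b', hb'⟩ := S.exists_dual ⟨i, q, l₀⟩
    have h1 := hD.contract_left_mem hx b
    have e1 : TensorProduct.lid E X (b.rTensor X (Coalgebra.comul (R := E)
        (∑ s, α s • S.elt i s.1 s.2))) = ∑ l, α (j₀, l) • S.elt i p l := by
      simp only [map_sum, map_smul, S.comul_elt, LinearMap.rTensor_tmul, TensorProduct.lid_tmul, hb,
        Fintype.sum_prod_type, Sigma.mk.injEq, heq_eq_eq, true_and, Prod.mk.injEq]
      rw [Finset.sum_comm]
      refine Finset.sum_congr rfl fun l _ => ?_
      rw [Finset.sum_eq_single j₀, Finset.sum_eq_single p] <;> simp +contextual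
    rw [e1] at h1
    have h2 := hD.contract_right_mem h1 b'
    have e2 : TensorProduct.rid E X (b'.lTensor X (Coalgebra.comul (R := E)
        (∑ l, α (j₀, l) • S.elt i p l))) = α (j₀, l₀) • S.elt i p q := by
      simp only [map_sum, map_smul, S.comul_elt, LinearMap.lTensor_tmul, TensorProduct.rid_tmul, hb',
        Sigma.mk.injEq, heq_eq_eq, true_and, Prod.mk.injEq]
      rw [Finset.sum_eq_single l₀, Finset.sum_eq_single q] <;> simp +contextual
    rw [e2] at h2
    exact (D.smul_mem_iff hα).1 h2

theorem dim_eq_one_of_isPointed (h : IsPointedCoalgebra E X) (i : Fin S.size) : S.dim i = 1 := by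
  have h1 := h _ (S.isSimpleSubcoalgebra_span i)
  by_contra hne
  have hpos := S.dim_pos i
  obtain ⟨v, -, hv⟩ := finrank_eq_one_iff'.1 h1
  let z : Fin (S.dim i) := ⟨0, hpos⟩
  let o : Fin (S.dim i) := ⟨1, by omega⟩
  have hzo : o ≠ z := by simp [z, o]
  have hmem : ∀ j l, S.elt i j l ∈ Submodule.span E
      (Set.range fun p : Fin (S.dim i) × Fin (S.dim i) => S.elt i p.1 p.2) :=
    fun j l => Submodule.subset_span ⟨(j, l), rfl⟩
  obtain ⟨a, ha⟩ := hv ⟨_, hmem z z⟩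
  obtain ⟨a', ha'⟩ := hv ⟨_, hmem z o⟩
  have ha := congrArg Subtype.val ha
  have ha' := congrArg Subtype.val ha'
  change a • (v : X) = S.elt i z z at ha
  change a' • (v : X) = S.elt i z o at ha'
  have e : a • S.elt i z o = a' • S.elt i z z := by rw [← ha, ← ha', smul_comm]
  obtain ⟨b, hb⟩ := S.exists_dual ⟨i, z, z⟩
  have e2 := congrArg b e
  simp only [map_smul, hb, Sigma.mk.injEq, heq_eq_eq, true_and, Prod.mk.injEq, hzo, if_false,
    if_true, smul_eq_mul, mul_one] at e2
  rw [← e2, mul_zero, zero_smul] at ha'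
  exact S.elt_ne_zero _ _ _ ha'.symm

/-- A subcoalgebra meeting the span trivially would carry a functional equal to the counit on it and
zero on all comatrix elements. This functional is nilpotent, yet its powers restrict to the counit,
so the counit, and hence the subcoalgebra, is zero. -/
theorem exists_mem_span_elt [FiniteDimensional E X] {D : Submodule E X} (hD : IsSubcoalgebra E D)
    (hne : D ≠ ⊥) : ∃ x ∈ D, x ≠ 0 ∧ x ∈ Submodule.span E (Set.range
      fun s : (i : Fin S.size) × Fin (S.dim i) × Fin (S.dim i) => S.elt s.1 s.2.1 s.2.2) := by
  set D₀ := Submodule.span E (Set.range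
      fun s : (i : Fin S.size) × Fin (S.dim i) × Fin (S.dim i) => S.elt s.1 s.2.1 s.2.2) with hD₀
  by_contra! hdis
  apply hne
  have hinj : LinearMap.ker (D₀.mkQ ∘ₗ D.subtype) = ⊥ := by
    rw [LinearMap.ker_eq_bot']
    rintro ⟨x, hx⟩ h
    have hx0 : x ∈ D₀ := (Submodule.Quotient.mk_eq_zero D₀).1 h
    by_contra hx1
    exact hdis x hx (fun h => hx1 (Subtype.ext h)) hx0
  obtain ⟨g, hg⟩ := LinearMap.exists_leftInverse_of_injective _ hinj
  -- `g` retracts the embedding of `D` into the quotient by the span `D₀`.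
  let b : X →ₗ[E] E := Coalgebra.counit ∘ₗ D.subtype ∘ₗ g ∘ₗ D₀.mkQ
  have hb : ∀ x ∈ D, b x = Coalgebra.counit (R := E) x := by
    intro x hx
    have := LinearMap.congr_fun hg ⟨x, hx⟩
    exact congrArg (fun y : D => Coalgebra.counit (R := E) (y : X)) this
  have hb0 : ∀ i j l, b (S.elt i j l) = 0 := by
    intro i j l
    have : D₀.mkQ (S.elt i j l) = 0 :=
      (Submodule.Quotient.mk_eq_zero D₀).2 (Submodule.subset_span ⟨⟨i, j, l⟩, rfl⟩)
    simp [b, this]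
  have hcomul : ∀ x : X, twistedComul E X 0 x = Coalgebra.comul (R := E) x :=
    fun x => by simp [twistedComul]
  obtain ⟨m, hm⟩ := S.isNilpotent_conv 0 hb0
  have hpow : ∀ m : ℕ, ∀ x ∈ D, ((conv 0 b ^ m).ofConv : X →ₗ[E] E) x =
      Coalgebra.counit (R := E) x := by
    intro m
    induction m with
    | zero => intro x _; rfl
    | succ m ih =>
      intro x hx
      rw [pow_succ]
      have h1 := hD.mul'_map_congr ih hb hx
      have h2 := (conv_mul_eq_one_iff (k := E) 0 _ _).1 (counit_conv (k := E) (C := X) 0) x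
      rw [hcomul] at h2
      refine Eq.trans ?_ (h1.trans h2)
      rw [← hcomul]
      rfl
  have hε : ∀ x ∈ D, Coalgebra.counit (R := E) x = 0 := by
    intro x hx
    rw [← hpow m x hx, hm]
    rfl
  rw [eq_bot_iff]
  intro x hx
  have h1 := Coalgebra.rTensor_counit_comul (R := E) x
  have h2 : (Coalgebra.counit (R := E)).rTensor X (Coalgebra.comul (R := E) x) = 0 := by
    obtain ⟨w, hw⟩ := hD x hx
    rw [← hw]
    clear hw
    induction w with
    | zero => simp
    | add x y hx hy => simp only [map_add, hx, hy, add_zero]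
    | tmul x y => simp [hε x x.2]
  have h3 := congrArg (TensorProduct.lid E X) (h1.symm.trans h2)
  simpa using h3

/-- The comatrix elements are now group-like. A simple `D` contains a nonzero combination of them,
contraction with a dual functional isolates one, and by simplicity its line is all of `D`. -/
theorem isPointed_of_dim_eq_one [FiniteDimensional E X] (h : ∀ i, S.dim i = 1) :
    IsPointedCoalgebra E X := by
  intro D hD
  have hsub : ∀ i, Subsingleton (Fin (S.dim i)) := fun i => by rw [h i]; infer_instance
  have hcomul : ∀ i j l, Coalgebra.comul (R := E) (S.elt i j l) =
      S.elt i j l ⊗ₜ[E] S.elt i j l := by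
    intro i j l
    rw [S.comul_elt, Fintype.sum_subsingleton _ l, Subsingleton.elim j l]
  obtain ⟨x, hx, hx0, hspan⟩ := S.exists_mem_span_elt hD.1 hD.2.1
  obtain ⟨α, rfl⟩ := (Submodule.mem_span_range_iff_exists_fun E).1 hspan
  obtain ⟨⟨i, j, l⟩, hα⟩ : ∃ s, α s ≠ 0 := by
    by_contra! h
    exact hx0 (by simp [h])
  obtain ⟨b, hb⟩ := S.exists_dual ⟨i, j, l⟩
  have h1 := hD.1.contract_left_mem hx b
  simp only [map_sum, map_smul, hcomul, LinearMap.rTensor_tmul, TensorProduct.lid_tmul, hb] at h1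
  rw [Finset.sum_eq_single ⟨i, j, l⟩ (by intro s _ hs; rw [if_neg hs, zero_smul, smul_zero])
    (by simp), if_pos rfl, one_smul] at h1
  have h2 : S.elt i j l ∈ D := (D.smul_mem_iff hα).1 h1
  have h3 : Submodule.span E {S.elt i j l} = D := by
    refine (hD.2.2 _ (isSubcoalgebra_span ?_) (by simpa using h2)).resolve_left ?_
    · rintro _ rfl
      rw [hcomul]
      have := Submodule.mem_span_singleton_self (R := E) (S.elt i j l)
      exact tmul_mem_range_map_subtype this this
    · rw [Submodule.span_singleton_eq_bot]
      exact S.elt_ne_zero i j l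
  rw [← h3]
  exact finrank_span_singleton (S.elt_ne_zero i j l)

end ComatrixSystem

end Pointed

/-! ### Chains of convolution inverses and the subalgebras containing their values. -/

section Chains

open WithConv FreeHopfAlgebra

/-- `f` and `g` are mutually inverse in the convolution algebra of the `n`-fold co-opposite
of `C`. -/
def IsConvInverse {k : Type u} {C : Type v} [Field k] [AddCommGroup C] [Module k C] [Coalgebra k C]
    {A : Type w} [Ring A] [Algebra k A] (n : ℕ) (f g : C →ₗ[k] A) : Prop :=
  conv n f * conv n g = 1 ∧ conv n g * conv n f = 1

theorem exists_factor_subalgebra {k : Type u} {C : Type v} [Field k] [AddCommGroup C] [Module k C]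
    {A : Type w} [Ring A] [Algebra k A] (S : Subalgebra k A) {f : C →ₗ[k] A} (hf : ∀ x, f x ∈ S) :
    ∃ F : C →ₗ[k] S, f = S.val.toLinearMap ∘ₗ F :=
  ⟨LinearMap.codRestrict (Subalgebra.toSubmodule S) f hf, rfl⟩

section

variable {k : Type u} {C : Type v} [Field k] [AddCommGroup C] [Module k C] [Coalgebra k C]
  {A : Type w} [Ring A] [Algebra k A]

theorem IsConvInverse.right_unique {n : ℕ} {f g g' : C →ₗ[k] A} (h : IsConvInverse n f g)
    (h' : IsConvInverse n f g') : g = g' := by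
  have e : conv n g = conv n g' := left_inv_eq_right_inv h.2 h'.1
  exact congrArg WithConv.ofConv e

theorem IsConvInverse.comp {B : Type*} [Ring B] [Algebra k B] {n : ℕ} {f g : C →ₗ[k] A}
    (h : IsConvInverse n f g) (φ : A →ₐ[k] B) :
    IsConvInverse n (φ.toLinearMap ∘ₗ f) (φ.toLinearMap ∘ₗ g) :=
  ⟨conv_comp_mul n φ h.1, conv_comp_mul n φ h.2⟩

end

section Matrices

variable {ι : Type*} [Fintype ι] [DecidableEq ι]

theorem IsTwistInverse.right_unique {R : Type*} [Ring R] {n : ℕ} {M N N' : Matrix ι ι R}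
    (h : IsTwistInverse n M N) (h' : IsTwistInverse n M N') : N = N' :=
  twistMatrix_injective n (left_inv_eq_right_inv h.2 h'.1)

/-- A `1 × 1` matrix equals its transpose, so the parity of the index is irrelevant. -/
theorem IsTwistInverse.of_subsingleton [Subsingleton ι] {R : Type*} [Ring R] {m n : ℕ}
    {M N : Matrix ι ι R} (h : IsTwistInverse m M N) : IsTwistInverse n N M := by
  have key : ∀ (n : ℕ) (M : Matrix ι ι R), twistMatrix n M = M := by
    intro n M
    ext i j
    rw [Subsingleton.elim i j]
    unfold twistMatrix
    split_ifs <;> rfl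
  unfold IsTwistInverse at h ⊢
  simp only [key] at h ⊢
  exact h.symm

theorem IsTwistInverse.of_map {R R' : Type*} [Ring R] [Ring R'] {n : ℕ} {M N : Matrix ι ι R}
    {φ : R →+* R'} (hφ : Function.Injective φ) (h : IsTwistInverse n (M.map φ) (N.map φ)) :
    IsTwistInverse n M N := by
  have hinj : Function.Injective (φ.mapMatrix : Matrix ι ι R →+* Matrix ι ι R') :=
    Matrix.map_injective hφ
  have key : ∀ M : Matrix ι ι R, twistMatrix n (M.map φ) = φ.mapMatrix (twistMatrix n M) := by
    intro M
    unfold twistMatrix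
    split_ifs <;> rfl
  unfold IsTwistInverse at h ⊢
  rw [key, key, ← map_mul, ← map_mul] at h
  exact ⟨hinj (h.1.trans (map_one _).symm), hinj (h.2.trans (map_one _).symm)⟩

end Matrices

namespace ComatrixSystem

variable {E : Type u} {X : Type v} [Field E] [AddCommGroup X] [Module E X] [Coalgebra E X]
  (S : ComatrixSystem E X) {R : Type w} [Ring R] [Algebra E R]

theorem isTwistInverse_values {n : ℕ} {f g : X →ₗ[E] R} (h : IsConvInverse n f g)
    (i : Fin S.size) : IsTwistInverse n (S.values f i) (S.values g i) := by
  constructor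
  · rw [← S.values_conv_mul, h.1, S.values_one]
  · rw [← S.values_conv_mul, h.2, S.values_one]

theorem values_val_comp (A : Subalgebra E R) (F : X →ₗ[E] A) (i : Fin S.size) :
    S.values (A.val.toLinearMap ∘ₗ F) i = (S.values F i).map A.val.toRingHom :=
  rfl

variable [FiniteDimensional E X]

theorem exists_isConvInverse {n : ℕ} {f : X →ₗ[E] R}
    {t : ∀ i, Matrix (Fin (S.dim i)) (Fin (S.dim i)) R}
    (h : ∀ i, IsTwistInverse n (S.values f i) (t i)) :
    ∃ g : X →ₗ[E] R, IsConvInverse n f g ∧ S.values g = t := by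
  obtain ⟨g, h1, h2, h3⟩ := S.exists_conv_inverse n f t h
  exact ⟨g, ⟨h1, h2⟩, h3⟩

/-- Convolution inverses exist in a subalgebra once the matrices of values are invertible there. -/
theorem exists_isConvInverse_mem (A : Subalgebra E R) {n : ℕ} {f : X →ₗ[E] R} (hf : ∀ x, f x ∈ A)
    {t : ∀ i, Matrix (Fin (S.dim i)) (Fin (S.dim i)) R} (ht : ∀ i j l, t i j l ∈ A)
    (h : ∀ i, IsTwistInverse n (S.values f i) (t i)) :
    ∃ g : X →ₗ[E] R, IsConvInverse n f g ∧ S.values g = t ∧ ∀ x, g x ∈ A := by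
  obtain ⟨F, rfl⟩ := exists_factor_subalgebra A hf
  have hA : Function.Injective A.val := Subtype.val_injective
  obtain ⟨G, hG, hGt⟩ := S.exists_isConvInverse (n := n) (f := F)
    (t := fun i => Matrix.of fun j l => ⟨t i j l, ht i j l⟩) fun i =>
      IsTwistInverse.of_map (φ := A.val.toRingHom) hA (h i)
  refine ⟨A.val.toLinearMap ∘ₗ G, hG.comp A.val, ?_, fun x => (G x).2⟩
  funext i
  rw [values_val_comp, hGt]
  rfl

/-- Over a split pointed coalgebra, all members of a chain of convolution inverses take values
in the subalgebra generated by the first two. -/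
theorem chain_mem_of_dim_eq_one (hS : ∀ i, S.dim i = 1) (A : Subalgebra E R)
    {f : ℕ → X →ₗ[E] R} (hf : ∀ n, IsConvInverse n (f n) (f (n + 1))) (h0 : ∀ x, f 0 x ∈ A)
    (h1 : ∀ x, f 1 x ∈ A) (n : ℕ) : ∀ x, f n x ∈ A := by
  have key : ∀ n, (∀ x, f n x ∈ A) ∧ ∀ x, f (n + 1) x ∈ A := by
    intro n
    induction n with
    | zero => exact ⟨h0, h1⟩
    | succ n ih =>
      refine ⟨ih.2, ?_⟩
      -- The inverse matrices are those of `f n`, already in `A`; only the values of the inverse off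
      -- the coradical are new.
      obtain ⟨g, hg, -, hgA⟩ := S.exists_isConvInverse_mem A (n := n + 1) ih.2
        (t := S.values (f n)) (fun i j l => ih.1 _) fun i => by
          have : Subsingleton (Fin (S.dim i)) := by rw [hS i]; infer_instance
          exact (S.isTwistInverse_values (hf n) i).of_subsingleton
      rw [(hf (n + 1)).right_unique hg]
      exact hgA
  exact (key n).1

/-- A coalgebra with a simple subcoalgebra that is not one-dimensional has chains of convolution
inverses that leave a subalgebra at a prescribed index. -/
theorem exists_chain_of_two_le_dim {i₀ : Fin S.size} (hi₀ : 2 ≤ S.dim i₀) (N : ℕ) :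
    ∃ (R : Type u) (_ : Ring R) (_ : Algebra E R) (A : Subalgebra E R) (f : ℕ → X →ₗ[E] R),
      (∀ n, IsConvInverse n (f n) (f (n + 1))) ∧ (∀ n ≤ N, ∀ x, f n x ∈ A) ∧
      ∃ x, f (N + 1) x ∉ A := by
  obtain ⟨R, _, _, A, t, ht, htA, j₀, l₀, hnot⟩ := exists_twistInverse_chain E N hi₀
  -- The escaping chain sits in the large block; the other blocks carry the constant identity chain.
  let T : ℕ → ∀ i, Matrix (Fin (S.dim i)) (Fin (S.dim i)) R :=
    fun n => Function.update (fun _ => 1) i₀ (t n)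
  have hT : ∀ n i, IsTwistInverse n (T n i) (T (n + 1) i) := by
    intro n i
    by_cases h : i = i₀
    · subst h
      simpa [T] using ht n
    · simpa [T, h] using isTwistInverse_one n
  have hTA : ∀ n ≤ N, ∀ i j l, T n i j l ∈ A := by
    intro n hn i j l
    by_cases h : i = i₀
    · subst h
      simpa [T] using htA n hn j l
    · simp only [T, Function.update_of_ne h, Matrix.one_apply]
      split_ifs
      exacts [A.one_mem, A.zero_mem]
  have base : ∃ f : X →ₗ[E] R, S.values f = T 0 ∧ (0 ≤ N → ∀ x, f x ∈ A) := by
    obtain ⟨F, hF⟩ := S.exists_values_eq (R := A)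
      fun i => Matrix.of fun j l => ⟨T 0 i j l, hTA 0 (Nat.zero_le _) i j l⟩
    refine ⟨A.val.toLinearMap ∘ₗ F, ?_, fun _ x => (F x).2⟩
    funext i
    rw [values_val_comp, hF]
    rfl
  -- Membership in `A` is carried as a condition for `n ≤ N`; beyond `N` the inverse is taken in all
  -- of `R`.
  have step : ∀ (n : ℕ) (f : {f : X →ₗ[E] R // S.values f = T n ∧ (n ≤ N → ∀ x, f x ∈ A)}),
      ∃ g : {f : X →ₗ[E] R // S.values f = T (n + 1) ∧ (n + 1 ≤ N → ∀ x, f x ∈ A)},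
        IsConvInverse n f.1 g.1 := by
    rintro n ⟨f, hf, hfA⟩
    by_cases hn : n + 1 ≤ N
    · obtain ⟨g, hg, hgT, hgA⟩ := S.exists_isConvInverse_mem A (hfA (by omega)) (hTA _ hn)
        fun i => by rw [hf]; exact hT n i
      exact ⟨⟨g, hgT, fun _ => hgA⟩, hg⟩
    · obtain ⟨g, hg, hgT⟩ := S.exists_isConvInverse (n := n) (f := f) (t := T (n + 1))
        fun i => by rw [hf]; exact hT n i
      exact ⟨⟨g, hgT, fun h => absurd h hn⟩, hg⟩
  obtain ⟨f₀, hf₀⟩ := base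
  choose next hnext using step
  let f : ∀ n, {f : X →ₗ[E] R // S.values f = T n ∧ (n ≤ N → ∀ x, f x ∈ A)} :=
    fun n => Nat.rec ⟨f₀, hf₀⟩ (fun n f => next n f) n
  refine ⟨R, inferInstance, inferInstance, A, fun n => (f n).1, fun n => hnext n (f n),
    fun n hn => (f n).2.2 hn, S.elt i₀ j₀ l₀, ?_⟩
  have h := congrFun (congrFun (congrFun (f (N + 1)).2.1 i₀) j₀) l₀
  change (f (N + 1)).1 (S.elt i₀ j₀ l₀) = _ at h
  rw [h]
  simpa [T] using hnot

end ComatrixSystem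

end Chains

/-! ### Extension and descent of scalars. -/

section BaseChange

open WithConv FreeHopfAlgebra

variable {k : Type u} [Field k] {C : Type v} [AddCommGroup C] [Module k C] [Coalgebra k C]
  {E : Type w} [Field E] [Algebra k E]

/-- The restriction of a linear map along `C → E ⊗ C`. -/
noncomputable def restrictBase {A : Type*} [Ring A] [Algebra k A] [Algebra E A]
    [IsScalarTower k E A] (f : E ⊗[k] C →ₗ[E] A) : C →ₗ[k] A :=
  f.restrictScalars k ∘ₗ TensorProduct.mk k E C 1

theorem mul'_map_twistedComul_one_tmul {A : Type*} [Ring A] [Algebra k A] [Algebra E A]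
    [IsScalarTower k E A] (f g : E ⊗[k] C →ₗ[E] A) (n : ℕ) (c : C) :
    LinearMap.mul' E A (TensorProduct.map f g (twistedComul E (E ⊗[k] C) n (1 ⊗ₜ[k] c))) =
      LinearMap.mul' k A (TensorProduct.map (restrictBase f) (restrictBase g)
        (twistedComul k C n c)) := by
  unfold twistedComul
  split_ifs
  · rw [TensorProduct.comul_tmul, CommSemiring.comul_apply]
    generalize Coalgebra.comul (R := k) c = z
    induction z with
    | zero => simp
    | add x y hx hy => simp only [TensorProduct.tmul_add, map_add, hx, hy]
    | tmul x y => simp [restrictBase]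
  · rw [LinearMap.comp_apply, LinearMap.comp_apply, TensorProduct.comul_tmul,
      CommSemiring.comul_apply]
    generalize Coalgebra.comul (R := k) c = z
    induction z with
    | zero => simp
    | add x y hx hy => simp only [TensorProduct.tmul_add, map_add, hx, hy]
    | tmul x y => simp [restrictBase]

/-- Both sides of the inverse relation are `E`-linear, so it suffices to test it on the elements `1
⊗ c`. -/
theorem conv_mul_eq_one_iff_restrictBase {A : Type*} [Ring A] [Algebra k A] [Algebra E A]
    [IsScalarTower k E A] (f g : E ⊗[k] C →ₗ[E] A) (n : ℕ) :
    conv n f * conv n g = 1 ↔ conv n (restrictBase f) * conv n (restrictBase g) = 1 := by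
  rw [conv_mul_eq_one_iff, conv_mul_eq_one_iff]
  have hε : ∀ c : C, algebraMap E A (Coalgebra.counit (R := E) ((1 : E) ⊗ₜ[k] c)) =
      algebraMap k A (Coalgebra.counit (R := k) c) := by
    intro c
    rw [TensorProduct.counit_tmul, CommSemiring.counit_apply, ← Algebra.algebraMap_eq_smul_one,
      ← IsScalarTower.algebraMap_apply]
  constructor
  · intro h c
    rw [← mul'_map_twistedComul_one_tmul, h, hε]
  · intro h x
    induction x with
    | zero => simp
    | add x y hx hy => simp only [map_add, hx, hy]
    | tmul e c =>
      have : e ⊗ₜ[k] c = e • ((1 : E) ⊗ₜ[k] c) := by rw [TensorProduct.smul_tmul', smul_eq_mul, mul_one]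
      rw [this]
      simp only [map_smul, smul_eq_mul, map_mul]
      rw [mul'_map_twistedComul_one_tmul, h, hε, Algebra.smul_def]

theorem isConvInverse_iff_restrictBase {A : Type*} [Ring A] [Algebra k A] [Algebra E A]
    [IsScalarTower k E A] (f g : E ⊗[k] C →ₗ[E] A) (n : ℕ) :
    IsConvInverse n f g ↔ IsConvInverse n (restrictBase f) (restrictBase g) :=
  and_congr (conv_mul_eq_one_iff_restrictBase f g n) (conv_mul_eq_one_iff_restrictBase g f n)

/-- The class of `y` in `H / A` dies in `E ⊗ (H / A)`, and `E` is faithfully flat over `k`. -/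
theorem mem_of_one_tmul_mem_baseChange {H : Type*} [Ring H] [Algebra k H] (A : Subalgebra k H)
    {y : H} (hy : (1 : E) ⊗ₜ[k] y ∈ A.baseChange E) : y ∈ A := by
  obtain ⟨z, hz⟩ := hy
  let q := (Subalgebra.toSubmodule A).mkQ
  have h : q.lTensor E ((1 : E) ⊗ₜ[k] y) = 0 := by
    rw [← hz]
    clear hz
    induction z with
    | zero => simp
    | add x y hx hy => rw [map_add, map_add, hx, hy, add_zero]
    | tmul e a =>
      have ha : q a = 0 := (Submodule.Quotient.mk_eq_zero (Subalgebra.toSubmodule A)).2 a.2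
      change e ⊗ₜ[k] q a = 0
      rw [ha, TensorProduct.tmul_zero]
  have h2 : q y = 0 :=
    Module.FaithfullyFlat.tensorProduct_mk_injective (A := k) (B := E) _
      (h.trans (TensorProduct.tmul_zero _ _).symm)
  exact (Submodule.Quotient.mk_eq_zero (Subalgebra.toSubmodule A)).1 h2

end BaseChange

/-! ### Generators of the free Hopf algebra and the two implications. -/

namespace FreeHopfAlgebra

variable {k : Type u} [Field k] {C : Type v} [AddCommGroup C] [Module k C] [Coalgebra k C]

theorem isConvInverse_gen (n : ℕ) : IsConvInverse n (gen k C n) (gen k C (n + 1)) :=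
  ⟨gen_right k C n, gen_left k C n⟩

theorem eq_top_of_gen_mem {A : Subalgebra k (FreeHopfAlgebra k C)} (h : ∀ n c, gen k C n c ∈ A) :
    A = ⊤ :=
  eq_top_iff.2 fun x _ => induction_on x A.algebraMap_mem h (fun _ _ => A.add_mem)
    fun _ _ => A.mul_mem

variable (k C) in
/-- The subalgebra generated by the copies of `C` up to the `n`-th. -/
noncomputable def genLE (n : ℕ) : Subalgebra k (FreeHopfAlgebra k C) :=
  Algebra.adjoin k {y | ∃ m ≤ n, ∃ c, gen k C m c = y}

theorem genLE_mono : Monotone (genLE k C) := fun _ _ h =>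
  Algebra.adjoin_mono fun _ ⟨m, hm, hc⟩ => ⟨m, hm.trans h, hc⟩

theorem exists_mem_genLE (x : FreeHopfAlgebra k C) : ∃ n, x ∈ genLE k C n := by
  induction x using induction_on with
  | halg r => exact ⟨0, Subalgebra.algebraMap_mem _ r⟩
  | hgen n c => exact ⟨n, Algebra.subset_adjoin ⟨n, le_rfl, c, rfl⟩⟩
  | hadd x y hx hy =>
    obtain ⟨m, hm⟩ := hx
    obtain ⟨n, hn⟩ := hy
    exact ⟨max m n, Subalgebra.add_mem _ (genLE_mono (le_max_left m n) hm)
      (genLE_mono (le_max_right m n) hn)⟩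
  | hmul x y hx hy =>
    obtain ⟨m, hm⟩ := hx
    obtain ⟨n, hn⟩ := hy
    exact ⟨max m n, Subalgebra.mul_mem _ (genLE_mono (le_max_left m n) hm)
      (genLE_mono (le_max_right m n) hn)⟩

/-- The algebra is the increasing union of the `genLE k C n`, so finitely many generators lie in one
of them. -/
theorem exists_genLE_eq_top (h : Algebra.FiniteType k (FreeHopfAlgebra k C)) :
    ∃ n, genLE k C n = ⊤ := by
  obtain ⟨s, hs⟩ := h.out
  choose N hN using exists_mem_genLE (k := k) (C := C)
  refine ⟨s.sup N, ?_⟩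
  rw [eq_top_iff, ← hs]
  exact Algebra.adjoin_le fun x hx => genLE_mono (Finset.le_sup hx) (hN x)

theorem fg_genLE [FiniteDimensional k C] (n : ℕ) : (genLE k C n).FG := by
  obtain ⟨s, hs⟩ := Module.Finite.fg_top (R := k) (M := C)
  classical
  refine ⟨(Finset.range (n + 1)).biUnion fun m => s.image (gen k C m), le_antisymm ?_ ?_⟩
  · refine Algebra.adjoin_mono fun y hy => ?_
    simp only [Finset.coe_biUnion, Set.mem_iUnion, Finset.coe_image] at hy
    obtain ⟨m, hm, c, -, rfl⟩ := hy
    exact ⟨m, Nat.lt_succ_iff.1 (Finset.mem_range.1 hm), c, rfl⟩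
  · refine Algebra.adjoin_le ?_
    rintro _ ⟨m, hm, c, rfl⟩
    have hle : Submodule.span k (s : Set C) ≤ (Subalgebra.toSubmodule (Algebra.adjoin k
        (((Finset.range (n + 1)).biUnion fun m => s.image (gen k C m) :
          Finset (FreeHopfAlgebra k C)) : Set (FreeHopfAlgebra k C)))).comap (gen k C m) := by
      refine Submodule.span_le.2 fun c hc => Algebra.subset_adjoin ?_
      rw [Finset.mem_coe, Finset.mem_biUnion]
      exact ⟨m, Finset.mem_range.2 (Nat.lt_succ_iff.2 hm), Finset.mem_image_of_mem _ hc⟩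
    rw [hs] at hle
    exact hle (Submodule.mem_top (x := c))

/-- If `E ⊗ C` is pointed, then `H_f(C)` is generated by `C` and `S(C)`. -/
theorem genLE_one_eq_top [FiniteDimensional k C] {E : Type w} [Field E] [IsAlgClosed E]
    [Algebra k E] (h : IsPointedCoalgebra E (E ⊗[k] C)) : genLE k C 1 = ⊤ := by
  obtain ⟨S⟩ := exists_comatrixSystem (E := E) (X := E ⊗[k] C)
  let f : ℕ → E ⊗[k] C →ₗ[E] E ⊗[k] FreeHopfAlgebra k C := fun n => (gen k C n).baseChange E
  have hf : ∀ n, IsConvInverse n (f n) (f (n + 1)) := fun n =>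
    (isConvInverse_iff_restrictBase _ _ n).2 ((isConvInverse_gen n).comp
      (Algebra.TensorProduct.includeRight : FreeHopfAlgebra k C →ₐ[k] E ⊗[k] FreeHopfAlgebra k C))
  have hmem : ∀ n ≤ 1, ∀ x, f n x ∈ (genLE k C 1).baseChange E := by
    intro n hn x
    induction x with
    | zero => rw [map_zero]; exact Subalgebra.zero_mem _
    | add x y hx hy => rw [map_add]; exact Subalgebra.add_mem _ hx hy
    | tmul e c =>
      have hc : gen k C n c ∈ genLE k C 1 := Algebra.subset_adjoin ⟨n, hn, c, rfl⟩
      exact Subalgebra.tmul_mem_baseChange hc e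
  refine eq_top_of_gen_mem fun n c => mem_of_one_tmul_mem_baseChange (E := E) _ ?_
  exact S.chain_mem_of_dim_eq_one (S.dim_eq_one_of_isPointed h) _ hf (hmem 0 (Nat.zero_le _))
    (hmem 1 le_rfl) n ((1 : E) ⊗ₜ[k] c)

theorem isPointed_of_finiteType [FiniteDimensional k C] {E : Type w} [Field E] [IsAlgClosed E]
    [Algebra k E] (h : Algebra.FiniteType k (FreeHopfAlgebra k C)) :
    IsPointedCoalgebra E (E ⊗[k] C) := by
  obtain ⟨S⟩ := exists_comatrixSystem (E := E) (X := E ⊗[k] C)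
  apply S.isPointed_of_dim_eq_one
  by_contra! hS
  obtain ⟨i, hi⟩ := hS
  obtain ⟨N, hN⟩ := exists_genLE_eq_top h
  obtain ⟨R, _, _, A, f, hf, hfA, x, hx⟩ := S.exists_chain_of_two_le_dim (i₀ := i)
    (by have := S.dim_pos i; omega) N
  let _ : Algebra k R := Algebra.compHom R (algebraMap k E)
  have : IsScalarTower k E R := IsScalarTower.of_algebraMap_eq fun _ => rfl
  have hf' := fun n => (isConvInverse_iff_restrictBase _ _ n).1 (hf n)
  -- The chain, restricted to `C`, defines a map that sends the generators up to index `N` into `A`.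
  -- As these generate everything, the term `N + 1` must land in `A` too, which the chain forbids.
  let φ : FreeHopfAlgebra k C →ₐ[k] R :=
    lift (fun n => restrictBase (f n)) (fun n => (hf' n).1) fun n => (hf' n).2
  have hφ : genLE k C N ≤ (A.restrictScalars k).comap φ := by
    refine Algebra.adjoin_le ?_
    rintro _ ⟨n, hn, c, rfl⟩
    change φ (gen k C n c) ∈ A
    rw [lift_gen]
    exact hfA n hn _
  rw [hN] at hφ
  have hall : ∀ x, f (N + 1) x ∈ A := by
    intro x
    induction x with
    | zero => rw [map_zero]; exact A.zero_mem
    | add x y hx hy => rw [map_add]; exact A.add_mem hx hy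
    | tmul e c =>
      have h1 : φ (gen k C (N + 1) c) ∈ A := hφ Algebra.mem_top
      rw [lift_gen] at h1
      have h2 : e ⊗ₜ[k] c = e • ((1 : E) ⊗ₜ[k] c) := by
        rw [TensorProduct.smul_tmul', smul_eq_mul, mul_one]
      rw [h2, map_smul]
      exact A.smul_mem h1 e
  exact hx (hall x)

end FreeHopfAlgebra

theorem mainTheorem9 (k : Type u) [Field k] (C : Type v) [AddCommGroup C] [Module k C]
    [Coalgebra k C] [FiniteDimensional k C] :
    Algebra.FiniteType k (FreeHopfAlgebra k C) ↔
      IsPointedCoalgebra (AlgebraicClosure k) (AlgebraicClosure k ⊗[k] C) := by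
  refine ⟨FreeHopfAlgebra.isPointed_of_finiteType, fun h => ⟨?_⟩⟩
  rw [← FreeHopfAlgebra.genLE_one_eq_top h]
  exact FreeHopfAlgebra.fg_genLE 1
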